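/- **Theorem.** Destructive coalitional weighted manipulation for the voting system SkS (Skating System Single) is in $\mathrm{P}$, i.e., the set of its (encoded) yes-instances is decided by a deterministic Turing machine in time polynomial in the length of the input; and so are its special cases SkS-DCM and SkS-DM, in which every voter has unit weight and, for SkS-DM, there is exactly one manipulator. *Weighted elections.* Let $C$ be a set of $m$ candidates and $V$ a list of votes, each a strict linear order over $C$ with a nonnegative integer weight $w_v$. Let $\mathrm{pos}_v(c)\in\{1,\dots,m\}$ be the position of $c$ in $v$, and put $\mathrm{maj}(V)=\lfloor \frac12\sum_{v} w_v\rfloor+1$, $$\mathrm{score}^i(c)=\sum_{v:\ \mathrm{pos}_v(c)\le i} w_v,\qquad \mathrm{sumpos}^i(c)=\sum_{v:\ \mathrm{pos}_v(c)\le i}\mathrm{pos}_v(c)\,w_v .$$ *SkS.* Let $i^*$ be the smallest stage $i\in\{1,\dots,m\}$ with $\mathrm{score}^i(c)\ge\mathrm{maj}(V)$ for some $c\in C$ (put $i^*=m$ if there is none, i.e., if the total weight is $0$). Start with $j=i^*$ and all candidates. In stage $j$, among the remaining candidates, let $C_j$ be the set of those with the highest $\mathrm{score}^j$. If $|C_j|=1$,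 its element is the unique winner. Otherwise let $C_j'\subseteq C_j$ be the set of those in $C_j$ with the lowest $\mathrm{sumpos}^j$. If $|C_j'|=1$, its element is the unique winner; if $|C_j'|>1$ and $j=m$, all candidates in $C_j'$ are winners; otherwise proceed to stage $j+1$ with only the candidates in $C_j'$ remaining (scores and positions are still taken in the original votes). *SkS-DCWM.* Given are a set $C$ of candidates, a list $V$ of nonmanipulative votes over $C$ with nonnegative integer weights, a list of nonnegative integer weights of the manipulators, and a distinguished candidate $c\in C$ (all numbers in binary). The question is whether the manipulators' votes $S$ can be set such that $c$ is not the unique SkS winner of the weighted election over $C$ with the votes $V\cup S$. -/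

import Mathlib

namespace Voting

open Computability

/-! ### Elections -/

/-- A vote (strict linear order) over the candidates `0, …, m - 1`, given as the bijection from
candidates to ranks; rank `0` is the most preferred one. -/
abbrev Vote (m : ℕ) : Type := Fin m ≃ Fin m

/-- `v.pos c` is the position of `c` in the vote `v`; positions are counted from `1`. -/
def Vote.pos {m : ℕ} (v : Vote m) (c : Fin m) : ℕ := (v c : ℕ) + 1

/-- The candidates in the order of the vote, most preferred first. -/
def Vote.ranking {m : ℕ} (v : Vote m) : List (Fin m) := List.ofFn v.symm

/-- A weighted election over the candidates `0, …, m - 1`: a list of votes, each of them with a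
nonnegative integer weight. -/
abbrev WeightedElection (m : ℕ) : Type := List (Vote m × ℕ)

/-- A voting system maps every weighted election to its set of winners. -/
abbrev VotingSystem : Type := ∀ m : ℕ, WeightedElection m → Finset (Fin m)

/-! ### The Skating System Single -/

namespace WeightedElection

variable {m : ℕ}

/-- The majority threshold: half of the total weight, rounded down, plus one. -/
def maj (V : WeightedElection m) : ℕ := (V.map Prod.snd).sum / 2 + 1

/-- The total weight of the votes that rank `c` among their top `i` positions. -/
def score (V : WeightedElection m) (i : ℕ) (c : Fin m) : ℕ :=
  (V.map fun p => if p.1.pos c ≤ i then p.2 else 0).sum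

/-- The weighted sum of the positions of `c` over the votes that rank `c` among their top `i`
positions. -/
def sumpos (V : WeightedElection m) (i : ℕ) (c : Fin m) : ℕ :=
  (V.map fun p => if p.1.pos c ≤ i then p.1.pos c * p.2 else 0).sum

/-- The candidates in `C` with the highest score in stage `j`. -/
def bestScore (V : WeightedElection m) (j : ℕ) (C : Finset (Fin m)) : Finset (Fin m) :=
  C.filter fun c => ∀ d ∈ C, V.score j d ≤ V.score j c

/-- The candidates in `C` with the lowest sum of positions in stage `j`. -/
def bestSumpos (V : WeightedElection m) (j : ℕ) (C : Finset (Fin m)) : Finset (Fin m) :=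
  C.filter fun c => ∀ d ∈ C, V.sumpos j c ≤ V.sumpos j d

/-- The first stage in `1, …, m` in which some candidate reaches the majority threshold. If there
is no such stage (which for `m ≥ 1` means that the total weight is `0`, so that all candidates tie
in every respect), it is the last stage `m`. -/
def firstStage (V : WeightedElection m) : ℕ :=
  ((List.range' 1 m).find? fun i => decide (∃ c, V.maj ≤ V.score i c)).getD m

/-- The stages `j, j + 1, …, m`, where `C` is the set of the candidates who are still in the
race in stage `j`. -/
def runStages (V : WeightedElection m) (j : ℕ) (C : Finset (Fin m)) : Finset (Fin m) :=
  let C₁ := V.bestScore j C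
  if C₁.card = 1 then C₁
  else
    let C₂ := V.bestSumpos j C₁
    if C₂.card = 1 then C₂
    else if m ≤ j then C₂
    else V.runStages (j + 1) C₂
termination_by m - j

end WeightedElection

/-- The Skating System Single. -/
def SkS : VotingSystem := fun _ V => V.runStages V.firstStage Finset.univ

/-! ### Destructive manipulation problems -/

/-- An instance of coalitional weighted manipulation: the candidates `0, …, numCand - 1`, the
nonmanipulative votes with their weights, the weights of the manipulators, and the distinguished
candidate. -/
structure ManipulationInstance where
  numCand : ℕ
  votes : WeightedElection numCand
  manipWeights : List ℕ
  target : Fin numCand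

/-- The manipulators have votes `S` (one for each of them) such that the distinguished candidate
is not the unique winner of the election in which all votes are cast. -/
def DestructiveSuccess (E : VotingSystem) (I : ManipulationInstance) : Prop :=
  ∃ S : List (Vote I.numCand), S.length = I.manipWeights.length ∧
    E I.numCand (I.votes ++ S.zip I.manipWeights) ≠ {I.target}

/-- All voters, manipulators included, have weight one. -/
def ManipulationInstance.Unweighted (I : ManipulationInstance) : Prop :=
  (∀ p ∈ I.votes, p.2 = 1) ∧ ∀ w ∈ I.manipWeights, w = 1

/-! ### Encoding of instances as strings -/

/-- A list in brackets, with a comma behind every entry. -/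
def encodeListWith {α : Type} (f : α → List Γ') (l : List α) : List Γ' :=
  Γ'.bra :: (l.flatMap (fun a => f a ++ [Γ'.comma]) ++ [Γ'.ket])

/-- A natural number in binary. -/
def encodeBinary (n : ℕ) : List Γ' := encodingNatΓ'.encode n

/-- A candidate is encoded by its number in binary. -/
def encodeCand {m : ℕ} (c : Fin m) : List Γ' := encodeBinary c

/-- A vote is the list of the candidates in order of preference; its weight is in binary. -/
def encodeWeightedVote {m : ℕ} (p : Vote m × ℕ) : List Γ' :=
  encodeListWith encodeCand p.1.ranking ++ encodeBinary p.2

/-- The list of the candidates, the list of the weighted votes, the list of the weights of the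
manipulators, and the distinguished candidate. -/
def ManipulationInstance.encode (I : ManipulationInstance) : List Γ' :=
  encodeListWith encodeCand (List.finRange I.numCand) ++
    encodeListWith encodeWeightedVote I.votes ++
    encodeListWith encodeBinary I.manipWeights ++
    encodeCand I.target

/-- Destructive coalitional weighted manipulation, as a language. -/
def DCWM (E : VotingSystem) : Language Γ' :=
  {w | ∃ I : ManipulationInstance, DestructiveSuccess E I ∧ I.encode = w}

/-- Destructive coalitional manipulation: all voters have unit weight. -/
def DCM (E : VotingSystem) : Language Γ' :=
  {w | ∃ I : ManipulationInstance, I.Unweighted ∧ DestructiveSuccess E I ∧ I.encode = w}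

/-- Destructive manipulation: all voters have unit weight and there is a single manipulator. -/
def DM (E : VotingSystem) : Language Γ' :=
  {w | ∃ I : ManipulationInstance, I.Unweighted ∧ I.manipWeights.length = 1 ∧
    DestructiveSuccess E I ∧ I.encode = w}

/-! ### The class P -/

open Classical in
/-- The class P: the languages whose characteristic function is computed in polynomial time by a
deterministic multi-stack Turing machine. The last clause makes all stack alphabets finite. -/
def InP {A : Type} (L : Language A) : Prop :=
  ∃ M : Turing.TM2ComputableInPolyTime (id : List A → List A) encodeBool
      (fun w => decide (w ∈ L)),
    ∀ k, Finite (M.tm.Γ k)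

/-! ### Different instances have different encodings -/

/-- `f a ++ [comma]` can be parsed uniquely from the left and does not start with `ket`. -/
def SelfDelimiting {α : Type} (f : α → List Γ') : Prop :=
  (∀ a b s t, f a ++ Γ'.comma :: s = f b ++ Γ'.comma :: t → a = b ∧ s = t) ∧
    ∀ a s t, f a ++ Γ'.comma :: s ≠ Γ'.ket :: t

theorem encodeListWith_append {α : Type} {f : α → List Γ'} (hf : SelfDelimiting f) :
    ∀ (k l : List α) (s t : List Γ'),
      encodeListWith f k ++ s = encodeListWith f l ++ t → k = l ∧ s = t
  | [], [], s, t, h => by simpa [encodeListWith] using h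
  | [], b :: l, s, t, h => by
    simp only [encodeListWith, List.flatMap_nil, List.flatMap_cons, List.nil_append,
      List.cons_append, List.append_assoc, List.cons.injEq, true_and] at h
    exact (hf.2 _ _ _ h.symm).elim
  | a :: k, [], s, t, h => by
    simp only [encodeListWith, List.flatMap_nil, List.flatMap_cons, List.nil_append,
      List.cons_append, List.append_assoc, List.cons.injEq, true_and] at h
    exact (hf.2 _ _ _ h).elim
  | a :: k, b :: l, s, t, h => by
    simp only [encodeListWith, List.flatMap_cons, List.nil_append,
      List.cons_append, List.append_assoc, List.cons.injEq, true_and] at h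
    obtain ⟨rfl, h'⟩ := hf.1 _ _ _ _ h
    obtain ⟨rfl, rfl⟩ := encodeListWith_append hf k l s t (by simpa [encodeListWith] using h')
    exact ⟨rfl, rfl⟩

theorem encodeBinary_injective : Function.Injective encodeBinary :=
  encodingNatΓ'.encode_injective

theorem bits_append_comma : ∀ (k l : List Bool) (s t : List Γ'),
    k.map inclusionBoolΓ' ++ Γ'.comma :: s = l.map inclusionBoolΓ' ++ Γ'.comma :: t →
      k = l ∧ s = t
  | [], [], s, t, h => by simpa using h
  | [], b :: l, s, t, h => by simp [inclusionBoolΓ'] at h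
  | a :: k, [], s, t, h => by simp [inclusionBoolΓ'] at h
  | a :: k, b :: l, s, t, h => by
    simp only [List.map_cons, List.cons_append, List.cons.injEq] at h
    obtain ⟨rfl, rfl⟩ := bits_append_comma k l s t h.2
    exact ⟨by rw [inclusionBoolΓ'_injective h.1], rfl⟩

theorem selfDelimiting_encodeBinary : SelfDelimiting encodeBinary := by
  refine ⟨fun a b s t h => ?_, fun a s t h => ?_⟩
  · obtain ⟨h1, h2⟩ := bits_append_comma (encodeNat a) (encodeNat b) s t h
    exact ⟨encodeBinary_injective (congrArg (List.map inclusionBoolΓ') h1), h2⟩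
  · have h' : (encodeNat a).map inclusionBoolΓ' ++ Γ'.comma :: s = Γ'.ket :: t := h
    cases hl : encodeNat a <;> simp [hl, inclusionBoolΓ'] at h'

theorem selfDelimiting_encodeCand {m : ℕ} : SelfDelimiting (encodeCand (m := m)) :=
  ⟨fun a b s t h => ⟨Fin.ext (selfDelimiting_encodeBinary.1 a b s t h).1,
    (selfDelimiting_encodeBinary.1 a b s t h).2⟩,
    fun a s t => selfDelimiting_encodeBinary.2 a s t⟩

theorem selfDelimiting_encodeWeightedVote {m : ℕ} :
    SelfDelimiting (encodeWeightedVote (m := m)) := by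
  refine ⟨fun a b s t h => ?_, fun a s t h => ?_⟩
  · simp only [encodeWeightedVote, List.append_assoc] at h
    obtain ⟨h1, h2⟩ := encodeListWith_append selfDelimiting_encodeCand _ _ _ _ h
    obtain ⟨h3, h4⟩ := selfDelimiting_encodeBinary.1 _ _ _ _ h2
    refine ⟨Prod.ext (Equiv.symm_bijective.1 (Equiv.ext fun i => ?_)) h3, h4⟩
    exact congrFun (List.ofFn_injective h1) i
  · simp [encodeWeightedVote, encodeListWith] at h

theorem ManipulationInstance.encode_injective : Function.Injective ManipulationInstance.encode := by
  rintro ⟨m, V, W, c⟩ ⟨m', V', W', c'⟩ h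
  simp only [ManipulationInstance.encode, List.append_assoc] at h
  have key : ∀ n : ℕ, encodeListWith encodeCand (List.finRange n)
      = encodeListWith encodeBinary ((List.finRange n).map Fin.val) := fun n => by
    simp only [encodeListWith, List.flatMap_map, encodeCand]
  rw [key, key] at h
  obtain ⟨h1, h⟩ := encodeListWith_append selfDelimiting_encodeBinary _ _ _ _ h
  have hm : m = m' := by simpa using congrArg List.length h1
  subst hm
  obtain ⟨rfl, h2⟩ := encodeListWith_append selfDelimiting_encodeWeightedVote _ _ _ _ h
  obtain ⟨rfl, h3⟩ := encodeListWith_append selfDelimiting_encodeBinary _ _ _ _ h2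
  have hc : c = c' := Fin.ext (encodeBinary_injective h3)
  rw [hc]

end Voting

/-!
Destructive manipulation of the Skating System Single is in P for two reasons.

*The problem is easy.* From the first stage `i*` on in which someone has a majority, the winners
are the lexicographic maxima of the sequences of pairs "score in stage `j`, then negative sum of
positions in stage `j`" (`WeightedElection.runStages_eq_singleton_iff`). So `c` fails to win alone
if and only if some `d ≠ c` is not behind `c` in the first stage from `i*` on in which the two
differ. The stage `i*` depends on all candidates, but it can be avoided: it is enough that `d` has
a majority in some stage `i`, that `c` has none in earlier stages, and that `d` withstands `c` from
stage `i` on, because if `i*` is earlier than `i`, then `c` is behind in stage `i*` anyway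
(`WeightedElection.sks_ne_singleton_iff`). This condition gets only easier to satisfy if `d` does
better or `c` does worse. Hence all manipulators may as well rank `d` first and `c` last, and the
order of the others is irrelevant (`destructiveSuccess_sks_iff`). What remains is to try all `d`
and all `i`. Sums of positions are compared without multiplications: among candidates with the same
score in stage `i`, the sum of positions is lower if and only if the sum of the scores in the
stages `1, …, i` is higher (`WeightedElection.key_lt_key_iff_sum_score`).

*Easy problems are solved by Turing machines.* Structured programs over stacks are compiled to
multi-stack machines with the same running time (`Exec.simulate`). Data are represented by binary
trees in prefix notation, and `PolyTime f` says that a structured program computes `f` in polynomial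
time on these representations. The class of these functions is closed under composition, pairing,
case distinction and iteration with results of polynomial size (`PolyTime.foldl_of_bound`), which
yields maps, bounded quantifiers, and the arithmetic of binary numbers. An input word is accepted
if it is the encoding of the data that a parser extracts from it, and these data come from an
instance that satisfies the condition above (`inP_of_raw`).
-/

namespace StackProg

open Computability Turing StateTransition Function

/-! ### Structured stack programs -/

/-- Structured programs over stacks that are indexed by the natural numbers and hold symbols
from `Γ'`. The constructs `case` and `loop` look at the top of stack `k`, which is `none` if the
stack is empty; the body of a loop is run as long as the condition `c` holds of it. A program
mentions finitely many stacks only. -/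
inductive Prog : Type
  | skip : Prog
  | push (k : ℕ) (a : Γ') : Prog
  | pop (k : ℕ) : Prog
  | seq (p q : Prog) : Prog
  | case (k : ℕ) (br : Option Γ' → Prog) : Prog
  | loop (k : ℕ) (c : Option Γ' → Bool) (p : Prog) : Prog

/-- The contents of all stacks, top of the stack first. -/
abbrev Stacks : Type := ℕ → List Γ'

/-- `Exec p s s' t`: the program `p`, started on the stacks `s`, terminates with the stacks `s'`
after at most `t` steps. -/
inductive Exec : Prog → Stacks → Stacks → ℕ → Prop
  | skip {s t} : 1 ≤ t → Exec .skip s s t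
  | push {k a s t} : 1 ≤ t → Exec (.push k a) s (update s k (a :: s k)) t
  | pop {k s t} : 1 ≤ t → Exec (.pop k) s (update s k (s k).tail) t
  | seq {p q s s₁ s₂ t₁ t₂ t} : Exec p s s₁ t₁ → Exec q s₁ s₂ t₂ → t₁ + t₂ ≤ t →
      Exec (.seq p q) s s₂ t
  | case {k br s s' t₁ t} : Exec (br (s k).head?) s s' t₁ → 1 + t₁ ≤ t → Exec (.case k br) s s' t
  | loopDone {k c p s t} : c (s k).head? = false → 1 ≤ t → Exec (.loop k c p) s s t
  | loopStep {k c p s s₁ s₂ t₁ t₂ t} : c (s k).head? = true → Exec p s s₁ t₁ →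
      Exec (.loop k c p) s₁ s₂ t₂ → 1 + t₁ + t₂ ≤ t → Exec (.loop k c p) s s₂ t

theorem Exec.mono {p : Prog} {s s' : Stacks} {t t' : ℕ} (h : Exec p s s' t) (htt : t ≤ t') :
    Exec p s s' t' := by
  cases h with
  | skip h => exact .skip (h.trans htt)
  | push h => exact .push (h.trans htt)
  | pop h => exact .pop (h.trans htt)
  | seq h₁ h₂ h => exact .seq h₁ h₂ (h.trans htt)
  | case h₁ h => exact .case h₁ (h.trans htt)
  | loopDone h₁ h => exact .loopDone h₁ (h.trans htt)
  | loopStep h₀ h₁ h₂ h => exact .loopStep h₀ h₁ h₂ (h.trans htt)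

/-! ### Translation into multi-stack Turing machines -/

/-- The program uses only the stacks below `n`. -/
def Prog.Fits (n : ℕ) : Prog → Prop
  | .skip => True
  | .push k _ => k < n
  | .pop k => k < n
  | .seq p q => p.Fits n ∧ q.Fits n
  | .case k br => k < n ∧ ∀ o, (br o).Fits n
  | .loop k _ p => k < n ∧ p.Fits n

theorem Prog.Fits.mono {n n' : ℕ} (h : n ≤ n') : ∀ {p : Prog}, p.Fits n → p.Fits n'
  | .skip, _ => trivial
  | .push _ _, hp => lt_of_lt_of_le hp h
  | .pop _, hp => lt_of_lt_of_le hp h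
  | .seq _ _, hp => ⟨hp.1.mono h, hp.2.mono h⟩
  | .case _ _, hp => ⟨lt_of_lt_of_le hp.1 h, fun o => (hp.2 o).mono h⟩
  | .loop _ _ _, hp => ⟨lt_of_lt_of_le hp.1 h, hp.2.mono h⟩

theorem Prog.exists_fits : ∀ p : Prog, ∃ n, p.Fits n
  | .skip => ⟨0, trivial⟩
  | .push k _ => ⟨k + 1, Nat.lt_succ_self k⟩
  | .pop k => ⟨k + 1, Nat.lt_succ_self k⟩
  | .seq p q => by
    obtain ⟨n, hn⟩ := p.exists_fits
    obtain ⟨n', hn'⟩ := q.exists_fits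
    exact ⟨max n n', hn.mono (le_max_left _ _), hn'.mono (le_max_right _ _)⟩
  | .case k br => by
    choose n hn using fun o => (br o).exists_fits
    exact ⟨max (k + 1) (Finset.univ.sup n), lt_of_lt_of_le (Nat.lt_succ_self k) (le_max_left _ _),
      fun o => (hn o).mono ((Finset.le_sup (Finset.mem_univ o)).trans (le_max_right _ _))⟩
  | .loop k _ p => by
    obtain ⟨n, hn⟩ := p.exists_fits
    exact ⟨max (k + 1) n, lt_of_lt_of_le (Nat.lt_succ_self k) (le_max_left _ _),
      hn.mono (le_max_right _ _)⟩

/-- The control points of a program. -/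
def Lab : Prog → Type
  | .skip => Unit
  | .push _ _ => Unit
  | .pop _ => Unit
  | .seq p q => Lab p ⊕ Lab q
  | .case _ br => Option (Σ o, Lab (br o))
  | .loop _ _ p => Option (Lab p)

/-- The control point at which the execution of a program begins. -/
def entry : (p : Prog) → Lab p
  | .skip => ()
  | .push _ _ => ()
  | .pop _ => ()
  | .seq p _ => Sum.inl (entry p)
  | .case _ _ => none
  | .loop _ _ _ => none

instance finite_lab : (p : Prog) → Finite (Lab p)
  | .skip => inferInstanceAs (Finite Unit)
  | .push _ _ => inferInstanceAs (Finite Unit)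
  | .pop _ => inferInstanceAs (Finite Unit)
  | .seq p q => by
    have := finite_lab p
    have := finite_lab q
    exact inferInstanceAs (Finite (Lab p ⊕ Lab q))
  | .case _ br => by
    have := fun o => finite_lab (br o)
    exact inferInstanceAs (Finite (Option (Σ o, Lab (br o))))
  | .loop _ _ p => by
    have := finite_lab p
    exact inferInstanceAs (Finite (Option (Lab p)))

/-- The stack alphabets of the machine: a Boolean output stack `none`, and the stacks of the
program. -/
abbrev Alph {n : ℕ} : Option (Fin n) → Type
  | none => Bool
  | some _ => Γ'

/-- The machine stack that stands for stack `k` of the program. -/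
abbrev stk (n k : ℕ) : Option (Fin (n + 1)) := some (Fin.ofNat (n + 1) k)

/-- Statements of the machine; its internal state is the last symbol that was looked at. -/
abbrev MStmt (n : ℕ) (Λ : Type) : Type := TM2.Stmt (Alph (n := n + 1)) Λ (Option Γ')

/-- The code of a program; `ι` places its control points among the labels of the machine, and `e`
is the label at which the machine goes on afterwards. -/
def compile (n : ℕ) {Λ : Type} : (p : Prog) → (Lab p → Λ) → Λ → Lab p → MStmt n Λ
  | .skip, _, e => fun _ => .goto fun _ => e
  | .push k a, _, e => fun _ => .push (stk n k) (fun _ => (a : Γ')) (.goto fun _ => e)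
  | .pop k, _, e => fun _ => .pop (stk n k) (fun v _ => v) (.goto fun _ => e)
  | .seq p q, ι, e => fun l => match l with
    | .inl l => compile n p (ι ∘ Sum.inl) (ι (Sum.inr (entry q))) l
    | .inr l => compile n q (ι ∘ Sum.inr) e l
  | .case k br, ι, e => fun l => match l with
    | none => .peek (stk n k) (fun _ o => o) (.goto fun v => ι (some ⟨v, entry (br v)⟩))
    | some ⟨o, l⟩ => compile n (br o) (fun l => ι (some ⟨o, l⟩)) e l
  | .loop k c p, ι, e => fun l => match l with
    | none => .peek (stk n k) (fun _ o => o)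
        (.goto fun v => if c v then ι (some (entry p)) else e)
    | some l => compile n p (ι ∘ some) (ι none) l

/-- The stacks of the machine, with an empty output stack. -/
def embed (n : ℕ) (s : Stacks) : ∀ k : Option (Fin (n + 1)), List (Alph k)
  | none => []
  | some i => s i

theorem embed_stk {n k : ℕ} (hk : k < n + 1) (s : Stacks) : embed n s (stk n k) = s k := by
  have : ((Fin.ofNat (n + 1) k : Fin (n + 1)) : ℕ) = k := by
    rw [Fin.val_ofNat, Nat.mod_eq_of_lt hk]
  exact congrArg s this

theorem update_embed {n k : ℕ} (hk : k < n + 1) (s : Stacks) (l : List Γ') :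
    update (embed n s) (stk n k) l = embed n (update s k l) := by
  have hk' : ((Fin.ofNat (n + 1) k : Fin (n + 1)) : ℕ) = k := by
    rw [Fin.val_ofNat, Nat.mod_eq_of_lt hk]
  funext i
  by_cases h : i = stk n k
  · subst h
    rw [update_self]
    exact (update_self k l s).symm.trans (congrArg (update s k l) hk'.symm)
  · rw [update_of_ne h]
    cases i with
    | none => rfl
    | some i =>
      have h' : (i : ℕ) ≠ k := fun e => h (congrArg some (Fin.ext (e.trans hk'.symm)))
      exact (update_of_ne h' l s).symm

/-- `b` is reached from `a` in at most `t` steps. -/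
def ReachesIn {σ : Type*} (f : σ → Option σ) (a b : σ) (t : ℕ) : Prop :=
  Nonempty (EvalsToInTime f a (some b) t)

theorem ReachesIn.mono {σ : Type*} {f : σ → Option σ} {a b : σ} {t t' : ℕ}
    (h : ReachesIn f a b t) (htt : t ≤ t') : ReachesIn f a b t' :=
  let ⟨⟨e, h⟩⟩ := h
  ⟨⟨e, h.trans htt⟩⟩

theorem ReachesIn.trans {σ : Type*} {f : σ → Option σ} {a b c : σ} {t t' : ℕ}
    (h : ReachesIn f a b t) (h' : ReachesIn f b c t') : ReachesIn f a c (t + t') :=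
  let ⟨h⟩ := h
  let ⟨h'⟩ := h'
  ⟨by rw [add_comm]; exact h.trans f _ _ _ _ _ h'⟩

theorem ReachesIn.single {σ : Type*} {f : σ → Option σ} {a b : σ} (h : f a = some b) :
    ReachesIn f a b 1 :=
  ⟨⟨⟨1, h⟩, le_rfl⟩⟩

section Step

variable {n k : ℕ} {Λ : Type} {M : Λ → MStmt n Λ} {l l' : Λ}

theorem step_push {a : Γ'} (hk : k < n + 1)
    (h : M l = .push (stk n k) (fun _ => (a : Γ')) (.goto fun _ => l')) (v : Option Γ')
    (s : Stacks) :
    TM2.step M ⟨some l, v, embed n s⟩ = some ⟨some l', v, embed n (update s k (a :: s k))⟩ := by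
  simp only [TM2.step, h, TM2.stepAux]
  rw [← update_embed hk, embed_stk hk]

theorem step_pop (hk : k < n + 1) (h : M l = .pop (stk n k) (fun v _ => v) (.goto fun _ => l'))
    (v : Option Γ') (s : Stacks) :
    TM2.step M ⟨some l, v, embed n s⟩ = some ⟨some l', v, embed n (update s k (s k).tail)⟩ := by
  simp only [TM2.step, h, TM2.stepAux]
  rw [← update_embed hk, embed_stk hk]

theorem step_peek {g : Option Γ' → Λ} (hk : k < n + 1) (s : Stacks)
    (h : M l = .peek (stk n k) (fun _ o => o) (.goto g)) (hg : g (s k).head? = l')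
    (v : Option Γ') :
    TM2.step M ⟨some l, v, embed n s⟩ = some ⟨some l', (s k).head?, embed n s⟩ := by
  simp only [TM2.step, h, TM2.stepAux]
  rw [embed_stk hk, hg]

end Step

/-- A machine that contains the code of `p` simulates the executions of `p`. -/
theorem Exec.simulate {n : ℕ} {Λ : Type} (M : Λ → MStmt n Λ) {p : Prog} {s s' : Stacks} {t : ℕ}
    (h : Exec p s s' t) (hp : p.Fits (n + 1)) (ι : Lab p → Λ) (e : Λ)
    (hM : ∀ l, M (ι l) = compile n p ι e l) (v : Option Γ') :
    ∃ v', ReachesIn (TM2.step M) ⟨some (ι (entry p)), v, embed n s⟩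
      ⟨some e, v', embed n s'⟩ t := by
  induction h generalizing e v with
  | skip h =>
    refine ⟨v, ReachesIn.mono (.single ?_) h⟩
    simp only [TM2.step, hM, compile, TM2.stepAux]
  | push h => exact ⟨v, ReachesIn.mono (.single (step_push hp (hM _) v _)) h⟩
  | pop h => exact ⟨v, ReachesIn.mono (.single (step_pop hp (hM _) v _)) h⟩
  | @seq p q s s₁ s₂ t₁ t₂ t _ _ ht ih₁ ih₂ =>
    obtain ⟨v₁, h₁⟩ := ih₁ hp.1 (ι ∘ Sum.inl) (ι (Sum.inr (entry q))) (fun l => hM (.inl l)) v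
    obtain ⟨v₂, h₂⟩ := ih₂ hp.2 (ι ∘ Sum.inr) e (fun l => hM (.inr l)) v₁
    exact ⟨v₂, (h₁.trans h₂).mono ht⟩
  | @case k br s s' t₁ t _ ht ih =>
    obtain ⟨v', h⟩ := ih (hp.2 _) (fun l => ι (some ⟨_, l⟩)) e
      (fun l => (hM (some ⟨_, l⟩)).trans (by rw [compile])) (s k).head?
    exact ⟨v', ReachesIn.mono (.trans (.single
      (step_peek (g := fun v => ι (some ⟨v, entry (br v)⟩)) hp.1 s
        ((hM none).trans (by rw [compile])) rfl v)) h) ht⟩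
  | @loopDone k c p s t hc h =>
    exact ⟨_, ReachesIn.mono (.single (step_peek hp.1 s (hM none) (if_neg (by simp [hc])) v)) h⟩
  | @loopStep k c p s s₁ s₂ t₁ t₂ t hc _ _ ht ih₁ ih₂ =>
    obtain ⟨v₁, h₁⟩ := ih₁ hp.2 (ι ∘ some) (ι none) (fun l => hM (some l)) (s k).head?
    obtain ⟨v₂, h₂⟩ := ih₂ hp ι e hM v₁
    exact ⟨v₂, ReachesIn.mono
      (.trans (.trans (.single (step_peek hp.1 s (hM none) (if_pos hc) v)) h₁) h₂) ht⟩

/-- The stacks of which only stack `0` is nonempty. -/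
def single (l : List Γ') : Stacks := update (fun _ => []) 0 l

theorem step_verdict {n : ℕ} {Λ : Type} {M : Λ → MStmt n Λ} {l : Λ} {w : List Γ'}
    (h : M l = (.pop (stk n 0) (fun _ o => o) <|
        .pop (stk n 0) (fun v _ => v) <| .pop (stk n 0) (fun v _ => v) <|
        .push none (fun v => decide (v = some (Γ'.bit true))) <| .load (fun _ => none) .halt))
    (hw : w.length ≤ 3) (v : Option Γ') :
    TM2.step M ⟨some l, v, embed n (single w)⟩ = some ⟨none, none,
      update (embed n (single [])) none [decide (w.head? = some (Γ'.bit true))]⟩ := by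
  have h0 : 0 < n + 1 := Nat.succ_pos n
  simp only [TM2.step, h, TM2.stepAux]
  rw [embed_stk h0, update_embed h0, embed_stk h0, update_embed h0, embed_stk h0, update_embed h0]
  have hw' : w.tail.tail.tail = [] := by
    apply List.eq_nil_of_length_eq_zero
    simp only [List.length_tail]
    omega
  simp [single, embed, hw']

/-- The machine of a decision program: it runs `p` and then moves the verdict, which is whether
the top of stack `0` is `Γ'.bit true`, to the output stack. The program has to leave at most three
symbols behind, all of them on stack `0`. -/
noncomputable def machine (n : ℕ) (p : Prog) : FinTM2 where
  K := Option (Fin (n + 1))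
  k₀ := stk n 0
  k₁ := none
  Γ := Alph
  Λ := Option (Lab p)
  main := some (entry p)
  ΛFin := Fintype.ofFinite _
  σ := Option Γ'
  initialState := none
  Γk₀Fin := inferInstanceAs (Fintype Γ')
  m
    | some l => compile n p some none l
    | none => .pop (stk n 0) (fun _ o => o) <|
        .pop (stk n 0) (fun v _ => v) <| .pop (stk n 0) (fun v _ => v) <|
        .push none (fun v => decide (v = some (Γ'.bit true))) <| .load (fun _ => none) .halt

theorem machine_outputs {n : ℕ} {p : Prog} (hp : p.Fits (n + 1)) {w v : List Γ'} {t : ℕ}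
    (h : Exec p (single w) (single v) t) (hv : v.length ≤ 3) :
    Nonempty (TM2OutputsInTime (machine n p) w
      (some [decide (v.head? = some (Γ'.bit true))]) (t + 1)) := by
  obtain ⟨v', h'⟩ := h.simulate (machine n p).m hp some none (fun _ => rfl) none
  have hinit : initList (machine n p) w = ⟨some (some (entry p)), none, embed n (single w)⟩ := by
    unfold initList
    congr 1
    funext k
    cases k with
    | none => rfl
    | some i =>
      by_cases hi : i = 0
      · subst hi
        rfl
      · have h1 : (some i : Option (Fin (n + 1))) ≠ stk n 0 := by simpa [stk] using hi
        have h2 : (i : ℕ) ≠ 0 := fun e => hi (Fin.ext e)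
        have h3 : embed n (single w) (some i) = [] := by simp [embed, single, update_of_ne h2]
        exact (dif_neg h1).trans h3.symm
  have hfinal : haltList (machine n p) [decide (v.head? = some (Γ'.bit true))] =
      ⟨none, none, update (embed n (single [])) none
        [decide (v.head? = some (Γ'.bit true))]⟩ := by
    unfold haltList
    congr 1
    funext k
    cases k with
    | none => rfl
    | some i =>
      have h3 : update (embed n (single [])) none [decide (v.head? = some (Γ'.bit true))] (some i) =
          [] := by
        rw [update_of_ne (Option.some_ne_none i)]
        simp [embed, single]
      exact (dif_neg (Option.some_ne_none i)).trans h3.symm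
  have hs : some (haltList (machine n p) [decide (v.head? = some (Γ'.bit true))]) =
    Option.map (haltList (machine n p)) (some [decide (v.head? = some (Γ'.bit true))]) := rfl
  unfold TM2OutputsInTime
  rw [← hs, hinit, hfinal]
  exact ReachesIn.trans h' (.single (step_verdict rfl hv v'))

/-! ### Elementary stack programs -/

/-- Moves stack `i` onto stack `j`, reversing it. -/
def rev (i j : ℕ) : Prog :=
  .loop i Option.isSome <| .case i fun
    | none => .skip
    | some a => .seq (.pop i) (.push j a)

theorem exec_rev_aux {i j : ℕ} (hij : i ≠ j) (s : Stacks) : ∀ A B : List Γ',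
    Exec (rev i j) (update (update s i A) j B) (update (update s i []) j (A.reverse ++ B))
      (4 * A.length + 1)
  | [], B => by
    refine .loopDone ?_ (by simp)
    simp [hij]
  | a :: A, B => by
    have h1 : update (update s i (a :: A)) j B i = a :: A := by simp [hij]
    refine Exec.loopStep (t₁ := 3) (by rw [h1]; rfl) (.case (t₁ := 2) ?_ le_rfl)
      (by rw [List.reverse_cons, List.append_assoc]; exact exec_rev_aux hij s A (a :: B))
      (by simp; omega)
    rw [h1]
    refine Exec.seq (.pop (le_refl 1)) ?_ (t₂ := 1) (le_refl 2)
    have h2 : update (update s i A) j (a :: B) =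
        update (update (update (update s i (a :: A)) j B) i A) j
          (a :: update (update (update s i (a :: A)) j B) i A j) := by
      rw [update_of_ne hij.symm, update_self, update_comm hij.symm, update_idem, update_idem]
    rw [h1, List.tail_cons, h2]
    exact .push le_rfl

theorem exec_rev {i j : ℕ} (hij : i ≠ j) (s : Stacks) :
    Exec (rev i j) s (update (update s i []) j ((s i).reverse ++ s j)) (4 * (s i).length + 1) := by
  simpa using exec_rev_aux hij s (s i) (s j)

/-- Moves stack `i` onto stack `j`, by way of the empty stack `k`. -/
def transfer (i j k : ℕ) : Prog := .seq (rev i k) (rev k j)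

theorem exec_transfer {i j k : ℕ} (hij : i ≠ j) (hik : i ≠ k) (hjk : j ≠ k) (s : Stacks)
    (hk : s k = []) :
    Exec (transfer i j k) s (update (update s i []) j (s i ++ s j)) (8 * (s i).length + 2) := by
  refine .seq (exec_rev hik s) ?_ (t₂ := 4 * (s i).length + 1) (by omega)
  convert exec_rev hjk.symm _ using 1
  · funext x
    by_cases h1 : x = j <;> by_cases h2 : x = k <;> by_cases h3 : x = i <;>
      simp_all [update_apply]
  · simp [hk]

/-- Copies stack `i` onto stack `j`, by way of the empty stack `k`. -/
def dup (i j k : ℕ) : Prog :=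
  .seq (rev i k) <| .loop k Option.isSome <| .case k fun
    | none => .skip
    | some a => .seq (.pop k) (.seq (.push i a) (.push j a))

theorem exec_dup {i j k : ℕ} (hij : i ≠ j) (hik : i ≠ k) (hjk : j ≠ k) (s : Stacks)
    (hk : s k = []) : Exec (dup i j k) s (update s j (s i ++ s j)) (9 * (s i).length + 2) := by
  -- The loop restores stack `i` while it fills stack `j`.
  have key : ∀ A B C : List Γ', Exec (.loop k Option.isSome <| .case k fun
      | none => .skip
      | some a => .seq (.pop k) (.seq (.push i a) (.push j a)))
      (update (update (update s i A) j B) k C)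
      (update (update (update s i (C.reverse ++ A)) j (C.reverse ++ B)) k [])
      (5 * C.length + 1) := by
    intro A B C
    induction C generalizing A B with
    | nil => exact .loopDone (by simp) (by simp)
    | cons a C ih =>
      refine Exec.loopStep (t₁ := 4) (by simp) (.case (t₁ := 3) ?_ le_rfl)
        (by simpa using ih (a :: A) (a :: B)) (by simp; omega)
      simp only [update_self, List.head?_cons]
      refine Exec.seq (.pop (le_refl 1)) (.seq (.push (le_refl 1)) ?_ (t₂ := 1) (le_refl 2))
        (le_refl 3)
      convert Exec.push (le_refl 1) using 1
      funext x
      by_cases h1 : x = j <;> by_cases h2 : x = k <;> by_cases h3 : x = i <;> simp_all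
  refine .seq (exec_rev hik s) ?_ (t₂ := 5 * (s i).length + 1) (by omega)
  convert key [] (s j) (s i).reverse using 1
  · simp [update_comm hij, hk]
  · funext x
    by_cases h1 : x = j <;> by_cases h2 : x = k <;> by_cases h3 : x = i <;>
      simp_all
  · simp

/-- Empties stack `i`. -/
def clear (i : ℕ) : Prog := .loop i Option.isSome (.pop i)

theorem exec_clear (i : ℕ) (s : Stacks) :
    Exec (clear i) s (update s i []) (2 * (s i).length + 1) := by
  have key : ∀ A : List Γ', Exec (clear i) (update s i A) (update s i []) (2 * A.length + 1) := by
    intro A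
    induction A with
    | nil => exact .loopDone (by simp) (by simp)
    | cons a A ih =>
      refine Exec.loopStep (t₁ := 1) (by simp) ?_ ih (by simp; omega)
      convert Exec.pop (le_refl 1) using 1
      simp
  simpa using key (s i)

/-! ### Trees on stacks -/

/-- Binary trees, the universal data type. -/
inductive BTree : Type
  | leaf : BTree
  | node (l r : BTree) : BTree

/-- The prefix notation of a tree. It is self-delimiting, so that the strings of several trees can
be concatenated. -/
def BTree.str : BTree → List Γ'
  | .leaf => [Γ'.bit false]
  | .node l r => Γ'.bit true :: (l.str ++ r.str)

/-- The first tree on stack `i` is moved onto stack `j` in reverse; the empty stack `c` counts the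
subtrees that are still to be read. -/
def split (i j c : ℕ) : Prog :=
  .seq (.push c (Γ'.bit true)) <| .loop c Option.isSome <| .case i fun
    | some (Γ'.bit true) => .seq (.pop i) (.seq (.push j (Γ'.bit true)) (.push c (Γ'.bit true)))
    | some a => .seq (.pop i) (.seq (.push j a) (.pop c))
    | none => .pop c

theorem exec_split {i j c : ℕ} (hij : i ≠ j) (hic : i ≠ c) (hjc : j ≠ c) (s : Stacks) (t : BTree)
    (A : List Γ') (hi : s i = t.str ++ A) (hc : s c = []) :
    Exec (split i j c) s (update (update s i A) j (t.str.reverse ++ s j))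
      (5 * t.str.length + 2) := by
  set L : Prog := .loop c Option.isSome <| .case i fun
    | some (Γ'.bit true) => .seq (.pop i) (.seq (.push j (Γ'.bit true)) (.push c (Γ'.bit true)))
    | some a => .seq (.pop i) (.seq (.push j a) (.pop c))
    | none => .pop c with hL
  -- Reading a tree takes one symbol off the counter, whatever happens afterwards.
  have key : ∀ (t : BTree) (A B C : List Γ') (x : Γ') (s' : Stacks) (T : ℕ),
      Exec L (update (update (update s i A) j (t.str.reverse ++ B)) c C) s' T →
      Exec L (update (update (update s i (t.str ++ A)) j B) c (x :: C)) s'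
        (T + 5 * t.str.length) := by
    intro t
    induction t with
    | leaf =>
      intro A B C x s' T h
      have h1 : ∀ X, update (update (update s i (BTree.leaf.str ++ A)) j B) c X i
          = Γ'.bit false :: A := by
        intro X; simp [hij, hic, BTree.str]
      refine Exec.loopStep (t₁ := 4) (by simp) (.case (t₁ := 3) ?_ le_rfl) h
        (by simp [BTree.str]; omega)
      rw [h1, List.head?_cons]
      refine Exec.seq (.pop (le_refl 1)) (.seq (.push (le_refl 1)) ?_ (t₂ := 1) (le_refl 2))
        (le_refl 3)
      convert Exec.pop (le_refl 1) using 1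
      rw [h1]
      funext x
      by_cases h1 : x = j <;> by_cases h2 : x = c <;> by_cases h3 : x = i <;>
        simp_all [update_apply, BTree.str]
    | node l r ihl ihr =>
      intro A B C x s' T h
      have h1 : ∀ X, update (update (update s i ((BTree.node l r).str ++ A)) j B) c X i
          = Γ'.bit true :: (l.str ++ (r.str ++ A)) := by
        intro X; simp [hij, hic, BTree.str]
      have h2 := ihl (r.str ++ A) (Γ'.bit true :: B) (x :: C) (Γ'.bit true) s' _
        (ihr A (l.str.reverse ++ Γ'.bit true :: B) C x s' T (by simpa [BTree.str] using h))
      refine Exec.loopStep (t₁ := 4) (by simp) (.case (t₁ := 3) ?_ le_rfl) h2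
        (by simp [BTree.str]; omega)
      rw [h1, List.head?_cons]
      refine Exec.seq (.pop (le_refl 1)) (.seq (.push (le_refl 1)) ?_ (t₂ := 1) (le_refl 2))
        (le_refl 3)
      convert Exec.push (le_refl 1) using 1
      rw [h1]
      funext x
      by_cases h1 : x = j <;> by_cases h2 : x = c <;> by_cases h3 : x = i <;>
        simp_all [update_apply, BTree.str]
  refine .seq (.push (le_refl 1)) (t₂ := 1 + 5 * t.str.length) ?_ (by omega)
  have := key t A (s j) [] (Γ'.bit true)
    (update (update (update s i A) j (t.str.reverse ++ s j)) c []) 1 (.loopDone (by simp) le_rfl)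
  convert this using 1
  · rw [hc, ← hi]; simp
  · funext x
    by_cases h1 : x = j <;> by_cases h2 : x = c <;> by_cases h3 : x = i <;> simp_all

/-- The stacks `b, b + 1, …` hold the entries of `l`, the stacks above are empty, and the stacks
below `b` are as in `s`. -/
def st (s : Stacks) (b : ℕ) (l : List (List Γ')) : Stacks :=
  fun k => if k < b then s k else l.getD (k - b) []

theorem st_append (s : Stacks) (b : ℕ) (l l' : List (List Γ')) :
    st s b (l ++ l') = st (st s b l) (b + l.length) l' := by
  funext k
  simp only [st]
  split_ifs with h1 h2 h2
  · rfl
  · omega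
  · exact List.getD_append _ _ _ _ (by omega)
  · rw [List.getD_append_right _ _ _ _ (by omega), Nat.sub_add_eq]

theorem st_append_replicate (s : Stacks) (b n : ℕ) (l : List (List Γ')) :
    st s b (l ++ List.replicate n []) = st s b l := by
  funext k
  simp only [st]
  split_ifs with h1
  · rfl
  · rcases lt_or_ge (k - b) l.length with h | h
    · exact List.getD_append _ _ _ _ h
    · rw [List.getD_append_right _ _ _ _ h, List.getD_eq_default _ _ h]
      simp

theorem st_apply (s : Stacks) (b i : ℕ) (l : List (List Γ')) : st s b l (b + i) = l.getD i [] := by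
  simp [st]

theorem update_st (s : Stacks) (b i : ℕ) (l : List (List Γ')) (x : List Γ') (h : i < l.length) :
    update (st s b l) (b + i) x = st s b (l.set i x) := by
  funext k
  by_cases hk : k = b + i
  · subst hk
    simp [st, h]
  · rw [update_of_ne hk]
    simp only [st]
    split_ifs with h1
    · rfl
    · rw [List.getD_eq_getElem?_getD, List.getD_eq_getElem?_getD, List.getElem?_set_ne (by omega)]

section

variable {s : Stacks} {b : ℕ}

theorem exec_transfer_st (i j k : ℕ) (l : List (List Γ')) (hi : i < l.length := by simp)
    (hj : j < l.length := by simp)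
    (hij : i ≠ j := by decide) (hik : i ≠ k := by decide) (hjk : j ≠ k := by decide)
    (hk : l.getD k [] = [] := by rfl) :
    Exec (transfer (b + i) (b + j) (b + k)) (st s b l)
      (st s b ((l.set i []).set j (l.getD i [] ++ l.getD j [])))
      (8 * (l.getD i []).length + 2) := by
  have h := exec_transfer (i := b + i) (j := b + j) (k := b + k) (by omega) (by omega) (by omega)
    (st s b l) (by rw [st_apply, hk])
  rwa [st_apply, st_apply, update_st _ _ _ _ _ hi, update_st _ _ _ _ _ (by simpa using hj)] at h

theorem exec_rev_st (i j : ℕ) (l : List (List Γ')) (hi : i < l.length := by simp)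
    (hj : j < l.length := by simp)
    (hij : i ≠ j := by decide) :
    Exec (rev (b + i) (b + j)) (st s b l)
      (st s b ((l.set i []).set j ((l.getD i []).reverse ++ l.getD j [])))
      (4 * (l.getD i []).length + 1) := by
  have h := exec_rev (i := b + i) (j := b + j) (by omega) (st s b l)
  rwa [st_apply, st_apply, update_st _ _ _ _ _ hi, update_st _ _ _ _ _ (by simpa using hj)] at h

theorem exec_dup_st (i j k : ℕ) (l : List (List Γ')) (hj : j < l.length := by simp)
    (hij : i ≠ j := by decide) (hik : i ≠ k := by decide) (hjk : j ≠ k := by decide)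
    (hk : l.getD k [] = [] := by rfl) :
    Exec (dup (b + i) (b + j) (b + k)) (st s b l) (st s b (l.set j (l.getD i [] ++ l.getD j [])))
      (9 * (l.getD i []).length + 2) := by
  have h := exec_dup (i := b + i) (j := b + j) (k := b + k) (by omega) (by omega) (by omega)
    (st s b l) (by rw [st_apply, hk])
  rwa [st_apply, st_apply, update_st _ _ _ _ _ hj] at h

theorem exec_clear_st (i : ℕ) (l : List (List Γ')) (hi : i < l.length := by simp) :
    Exec (clear (b + i)) (st s b l) (st s b (l.set i [])) (2 * (l.getD i []).length + 1) := by
  have h := exec_clear (b + i) (st s b l)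
  rwa [st_apply, update_st _ _ _ _ _ hi] at h

theorem exec_push_st (i : ℕ) (a : Γ') (l : List (List Γ')) (hi : i < l.length := by simp) :
    Exec (.push (b + i) a) (st s b l) (st s b (l.set i (a :: l.getD i []))) 1 := by
  have h := Exec.push (k := b + i) (a := a) (s := st s b l) le_rfl
  rwa [st_apply, update_st _ _ _ _ _ hi] at h

theorem exec_pop_st (i : ℕ) (l : List (List Γ')) (hi : i < l.length := by simp) :
    Exec (.pop (b + i)) (st s b l) (st s b (l.set i (l.getD i []).tail)) 1 := by
  have h := Exec.pop (k := b + i) (s := st s b l) le_rfl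
  rwa [st_apply, update_st _ _ _ _ _ hi] at h

theorem exec_split_st (i j c : ℕ) (l : List (List Γ')) (t : BTree) (A : List Γ')
    (hi : i < l.length := by simp)
    (hj : j < l.length := by simp) (hij : i ≠ j := by decide) (hic : i ≠ c := by decide)
    (hjc : j ≠ c := by decide) (hA : l.getD i [] = t.str ++ A := by rfl)
    (hc : l.getD c [] = [] := by rfl) :
    Exec (split (b + i) (b + j) (b + c)) (st s b l)
      (st s b ((l.set i A).set j (t.str.reverse ++ l.getD j []))) (5 * t.str.length + 2) := by
  have h := exec_split (i := b + i) (j := b + j) (c := b + c) (by omega) (by omega) (by omega)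
    (st s b l) t A (by rw [st_apply, hA]) (by rw [st_apply, hc])
  rwa [st_apply, update_st _ _ _ _ _ hi, update_st _ _ _ _ _ (by simpa using hj)] at h

/-- Executions do not depend on whether empty stacks are listed. -/
theorem Exec.of_pad {p : Prog} {l l' : List (List Γ')} {t : ℕ} (n n' : ℕ)
    (h : Exec p (st s b (l ++ List.replicate n [])) (st s b (l' ++ List.replicate n' [])) t) :
    Exec p (st s b l) (st s b l') t := by
  rwa [st_append_replicate, st_append_replicate] at h

theorem Exec.pad {p : Prog} {l l' : List (List Γ')} {t : ℕ} (h : Exec p (st s b l) (st s b l') t)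
    (n n' : ℕ) :
    Exec p (st s b (l ++ List.replicate n [])) (st s b (l' ++ List.replicate n' [])) t := by
  rwa [st_append_replicate, st_append_replicate]

/-- A program that transforms a single stack can be run on top of other stacks. -/
theorem exec_run {p : ℕ → Prog} {x y : List Γ'} {t : ℕ}
    (h : ∀ b s, Exec (p b) (st s b [x]) (st s b [y]) t) (l : List (List Γ')) (n : ℕ) :
    Exec (p (b + l.length)) (st s b (l ++ [x] ++ List.replicate n []))
      (st s b (l ++ [y] ++ List.replicate n [])) t := by
  rw [st_append_replicate, st_append_replicate, st_append, st_append]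
  exact h _ _

end

/-! ### Data -/

/-- Data types whose elements are represented by trees. -/
class Code (α : Type) where
  /-- The tree that represents an element. -/
  code : α → BTree

/-- The string that represents an element of a data type. -/
def str {α : Type} [Code α] (a : α) : List Γ' := (Code.code a).str

/-- The length of the representation. -/
def size {α : Type} [Code α] (a : α) : ℕ := (str a).length

instance : Code Unit := ⟨fun _ => .leaf⟩

instance : Code Bool := ⟨fun b => cond b (.node .leaf .leaf) .leaf⟩

instance {α β : Type} [Code α] [Code β] : Code (α × β) :=
  ⟨fun p => .node (Code.code p.1) (Code.code p.2)⟩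

/-- The tree of a list: a leaf for the empty list, and a node for each entry. -/
def codeList {α : Type} [Code α] : List α → BTree
  | [] => .leaf
  | a :: l => .node (Code.code a) (codeList l)

instance {α : Type} [Code α] : Code (List α) := ⟨codeList⟩

/-- Natural numbers are represented in binary. -/
instance : Code ℕ := ⟨fun n => Code.code n.bits⟩

section Size

variable {α β : Type} [Code α] [Code β]

theorem str_pair (a : α) (b : β) : str (a, b) = Γ'.bit true :: (str a ++ str b) := rfl

theorem str_nil : str ([] : List α) = [Γ'.bit false] := rfl

theorem str_cons (a : α) (l : List α) : str (a :: l) = Γ'.bit true :: (str a ++ str l) := rfl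

theorem size_pair (a : α) (b : β) : size (a, b) = size a + size b + 1 := by
  simp [size, str_pair]

theorem size_nil : size ([] : List α) = 1 := rfl

theorem size_cons (a : α) (l : List α) : size (a :: l) = size a + size l + 1 := by
  simp [size, str_cons]

theorem size_nat (n : ℕ) : size n = size n.bits := rfl

theorem size_pos (a : α) : 1 ≤ size a := by
  unfold size str
  cases Code.code a <;> simp [BTree.str]

theorem length_le_size (l : List α) : l.length ≤ size l := by
  induction l with
  | nil => simp
  | cons a l ih => simp only [List.length_cons, size_cons]; omega

theorem size_le_of_mem {a : α} {l : List α} (h : a ∈ l) : size a ≤ size l := by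
  induction l with
  | nil => simp at h
  | cons b l ih =>
    rw [size_cons]
    rcases List.mem_cons.1 h with rfl | h
    · omega
    · have := ih h
      omega

end Size

theorem eval_mono (P : Polynomial ℕ) {m n : ℕ} (h : m ≤ n) : P.eval m ≤ P.eval n := by
  simp only [Polynomial.eval_eq_sum, Polynomial.sum_def]
  gcongr

/-! ### Functions computable in polynomial time -/

/-- The function `f` is computed by a structured stack program in polynomial time. The program can
be placed on any stack `b`: it replaces the representation of `a` on stack `b` by that of `f a`,
uses stacks above `b` as scratch, which have to be empty, and does not touch those below `b`. -/
def PolyTime {α β : Type} [Code α] [Code β] (f : α → β) : Prop :=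
  ∃ (p : ℕ → Prog) (P : Polynomial ℕ), ∀ a, size (f a) ≤ P.eval (size a) ∧
    ∀ b s, Exec (p b) (st s b [str a]) (st s b [str (f a)]) (P.eval (size a))

section Closure

variable {α β γ δ σ : Type} [Code α] [Code β] [Code γ] [Code δ] [Code σ]

/-- A function that does not change the representation is computed by doing nothing. -/
theorem PolyTime.of_code {f : α → β} (h : ∀ a, Code.code (f a) = Code.code a) : PolyTime f := by
  have h' : ∀ a, str (f a) = str a := fun a => congrArg BTree.str (h a)
  refine ⟨fun _ => .skip, Polynomial.X + 1, fun a => ⟨?_, fun b s => ?_⟩⟩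
  · simp [size, h']
  · rw [h']
    exact .skip (by simp)

theorem PolyTime.id : PolyTime (fun a : α => a) := .of_code fun _ => rfl

theorem PolyTime.comp {g : β → γ} {f : α → β} (hg : PolyTime g) (hf : PolyTime f) :
    PolyTime (fun a => g (f a)) := by
  obtain ⟨p, P, hp⟩ := hf
  obtain ⟨q, Q, hq⟩ := hg
  refine ⟨fun b => .seq (p b) (q b), P + Q.comp P, fun a => ?_⟩
  have h := eval_mono Q (hp a).1
  rw [Polynomial.eval_add, Polynomial.eval_comp]
  exact ⟨((hq (f a)).1.trans h).trans (Nat.le_add_left _ _), fun b s =>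
    .seq ((hp a).2 b s) ((hq (f a)).2 b s) (Nat.add_le_add_left h _)⟩

/-- Pushes the symbols of a list, the first one last. -/
def pushAll (b : ℕ) : List Γ' → Prog
  | [] => .skip
  | a :: l => .seq (pushAll b l) (.push b a)

theorem exec_pushAll (b : ℕ) (s : Stacks) (l : List Γ') :
    Exec (pushAll b l) s (update s b (l ++ s b)) (l.length + 1) := by
  induction l with
  | nil => simpa [pushAll] using Exec.skip (s := s) (le_refl 1)
  | cons a l ih =>
    refine .seq ih ?_ (t₂ := 1) (by simp)
    convert Exec.push (le_refl 1) using 1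
    simp

theorem PolyTime.const (c : β) : PolyTime (fun _ : α => c) := by
  refine ⟨fun b => .seq (clear (b + 0)) (pushAll (b + 0) (str c)),
    2 * Polynomial.X + Polynomial.C (size c + 2), fun a => ⟨?_, fun b s => ?_⟩⟩
  · simp
    omega
  · have h1 : Exec (clear (b + 0)) (st s b [str a]) (st s b [[]]) (2 * size a + 1) :=
      exec_clear_st 0 [str a]
    have h2 : Exec (pushAll (b + 0) (str c)) (st s b [[]]) (st s b [str c]) (size c + 1) := by
      have h := exec_pushAll (b + 0) (st s b [[]]) (str c)
      rw [st_apply, update_st _ _ _ _ _ (by simp)] at h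
      simpa [size] using h
    refine .seq h1 h2 ?_
    simp
    omega

/-- From `x` and `y` on the stacks `b` and `b + 1` to the pair `(x, y)` on stack `b`. -/
def mkPair (b : ℕ) : Prog :=
  .seq (transfer (b + 0) (b + 2) (b + 3)) <| .seq (transfer (b + 1) (b + 0) (b + 3)) <|
    .seq (transfer (b + 2) (b + 0) (b + 3)) (.push (b + 0) (Γ'.bit true))

theorem exec_mkPair (b : ℕ) (s : Stacks) (x y : List Γ') :
    Exec (mkPair b) (st s b [x, y]) (st s b [Γ'.bit true :: (x ++ y)])
      (16 * x.length + 8 * y.length + 7) := by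
  have h1 : Exec (transfer (b + 0) (b + 2) (b + 3)) (st s b [x, y, [], []])
      (st s b [[], y, x, []]) (8 * x.length + 2) := by
    simpa using exec_transfer_st (s := s) (b := b) 0 2 3 [x, y, [], []]
  have h2 : Exec (transfer (b + 1) (b + 0) (b + 3)) (st s b [[], y, x, []])
      (st s b [y, [], x, []]) (8 * y.length + 2) := by
    simpa using exec_transfer_st (s := s) (b := b) 1 0 3 [[], y, x, []]
  have h3 : Exec (transfer (b + 2) (b + 0) (b + 3)) (st s b [y, [], x, []])
      (st s b [x ++ y, [], [], []]) (8 * x.length + 2) := by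
    simpa using exec_transfer_st (s := s) (b := b) 2 0 3 [y, [], x, []]
  have h4 : Exec (.push (b + 0) (Γ'.bit true)) (st s b [x ++ y, [], [], []])
      (st s b [Γ'.bit true :: (x ++ y), [], [], []]) 1 :=
    exec_push_st 0 (Γ'.bit true) [x ++ y, [], [], []]
  exact .of_pad 2 3 (.seq h1 (.seq h2 (.seq h3 h4 le_rfl) le_rfl) (by omega))

theorem PolyTime.pair {f : α → β} {g : α → γ} (hf : PolyTime f) (hg : PolyTime g) :
    PolyTime (fun a => (f a, g a)) := by
  obtain ⟨p, P, hp⟩ := hf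
  obtain ⟨q, Q, hq⟩ := hg
  refine ⟨fun b => .seq (dup (b + 0) (b + 1) (b + 2)) <| .seq (p (b + 1)) <|
    .seq (transfer (b + 0) (b + 2) (b + 3)) <| .seq (q (b + 2)) <|
    .seq (transfer (b + 1) (b + 0) (b + 3)) <| .seq (transfer (b + 2) (b + 1) (b + 3)) (mkPair b),
    17 * Polynomial.X + 25 * P + 17 * Q + 15, fun a => ?_⟩
  have hP := (hp a).1
  have hQ := (hq a).1
  refine ⟨?_, fun b s => ?_⟩
  · rw [size_pair]
    simp
    omega
  have h1 : Exec (dup (b + 0) (b + 1) (b + 2)) (st s b [str a, [], [], []])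
      (st s b [str a, str a, [], []]) (9 * size a + 2) := by
    simpa [size] using exec_dup_st (s := s) (b := b) 0 1 2 [str a, [], [], []]
  have h2 : Exec (p (b + 1)) (st s b [str a, str a, [], []])
      (st s b [str a, str (f a), [], []]) (P.eval (size a)) :=
    exec_run (b := b) (s := s) (hp a).2 [str a] 2
  have h3 : Exec (transfer (b + 0) (b + 2) (b + 3)) (st s b [str a, str (f a), [], []])
      (st s b [[], str (f a), str a, []]) (8 * size a + 2) := by
    simpa [size] using exec_transfer_st (s := s) (b := b) 0 2 3 [str a, str (f a), [], []]
  have h4 : Exec (q (b + 2)) (st s b [[], str (f a), str a, []])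
      (st s b [[], str (f a), str (g a), []]) (Q.eval (size a)) :=
    exec_run (b := b) (s := s) (hq a).2 [[], str (f a)] 1
  have h5 : Exec (transfer (b + 1) (b + 0) (b + 3)) (st s b [[], str (f a), str (g a), []])
      (st s b [str (f a), [], str (g a), []]) (8 * size (f a) + 2) := by
    simpa [size] using exec_transfer_st (s := s) (b := b) 1 0 3 [[], str (f a), str (g a), []]
  have h6 : Exec (transfer (b + 2) (b + 1) (b + 3)) (st s b [str (f a), [], str (g a), []])
      (st s b [str (f a), str (g a), [], []]) (8 * size (g a) + 2) := by
    simpa [size] using exec_transfer_st (s := s) (b := b) 2 1 3 [str (f a), [], str (g a), []]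
  have h7 : Exec (mkPair b) (st s b [str (f a), str (g a), [], []])
      (st s b [str (f a, g a), [], [], []]) (16 * size (f a) + 8 * size (g a) + 7) :=
    (exec_mkPair b s (str (f a)) (str (g a))).pad 2 3
  refine .of_pad 3 3 (.seq h1 (.seq h2 (.seq h3 (.seq h4 (.seq h5 (.seq h6 h7 le_rfl) le_rfl)
    le_rfl) le_rfl) le_rfl) ?_)
  simp
  omega

theorem PolyTime.fst : PolyTime (fun p : α × β => p.1) := by
  refine ⟨fun b => .seq (.pop (b + 0)) <| .seq (split (b + 0) (b + 1) (b + 2)) <|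
    .seq (clear (b + 0)) (rev (b + 1) (b + 0)), 11 * Polynomial.X + 5, fun a => ?_⟩
  have h := size_pair a.1 a.2
  refine ⟨?_, fun b s => ?_⟩
  · simp [h]
    omega
  have h1 : Exec (.pop (b + 0)) (st s b [str a, [], []]) (st s b [str a.1 ++ str a.2, [], []]) 1 :=
    exec_pop_st 0 [str a, [], []]
  have h2 : Exec (split (b + 0) (b + 1) (b + 2)) (st s b [str a.1 ++ str a.2, [], []])
      (st s b [str a.2, (str a.1).reverse, []]) (5 * size a.1 + 2) := by
    have := exec_split_st (s := s) (b := b) 0 1 2 [str a.1 ++ str a.2, [], []] (Code.code a.1)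
      (str a.2)
    simpa [← str.eq_1, size] using this
  have h3 : Exec (clear (b + 0)) (st s b [str a.2, (str a.1).reverse, []])
      (st s b [[], (str a.1).reverse, []]) (2 * size a.2 + 1) :=
    exec_clear_st 0 [str a.2, (str a.1).reverse, []]
  have h4 : Exec (rev (b + 1) (b + 0)) (st s b [[], (str a.1).reverse, []])
      (st s b [str a.1, [], []]) (4 * size a.1 + 1) := by
    simpa [size] using exec_rev_st (s := s) (b := b) 1 0 [[], (str a.1).reverse, []]
  refine .of_pad 2 2 (.seq h1 (.seq h2 (.seq h3 h4 le_rfl) le_rfl) ?_)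
  simp [h]
  omega

theorem PolyTime.snd : PolyTime (fun p : α × β => p.2) := by
  refine ⟨fun b => .seq (.pop (b + 0)) <| .seq (split (b + 0) (b + 1) (b + 2)) <|
    clear (b + 1), 7 * Polynomial.X + 5, fun a => ?_⟩
  have h := size_pair a.1 a.2
  refine ⟨?_, fun b s => ?_⟩
  · simp [h]
    omega
  have h1 : Exec (.pop (b + 0)) (st s b [str a, [], []]) (st s b [str a.1 ++ str a.2, [], []]) 1 :=
    exec_pop_st 0 [str a, [], []]
  have h2 : Exec (split (b + 0) (b + 1) (b + 2)) (st s b [str a.1 ++ str a.2, [], []])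
      (st s b [str a.2, (str a.1).reverse, []]) (5 * size a.1 + 2) := by
    have := exec_split_st (s := s) (b := b) 0 1 2 [str a.1 ++ str a.2, [], []] (Code.code a.1)
      (str a.2)
    simpa [← str.eq_1, size] using this
  have h3 : Exec (clear (b + 1)) (st s b [str a.2, (str a.1).reverse, []])
      (st s b [str a.2, [], []]) (2 * size a.1 + 1) := by
    simpa [size] using exec_clear_st (s := s) (b := b) 1 [str a.2, (str a.1).reverse, []]
  refine .of_pad 2 2 (.seq h1 (.seq h2 h3 le_rfl) ?_)
  simp [h]
  omega

/-- Case distinction on a list. -/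
theorem PolyTime.listCase {l : α → List β} {f : α → γ} {g : α × β × List β → γ} (hl : PolyTime l)
    (hf : PolyTime f) (hg : PolyTime g) :
    PolyTime (fun a => match l a with
      | [] => f a
      | x :: xs => g (a, x, xs)) := by
  obtain ⟨p, P, hp⟩ := hl
  obtain ⟨q, Q, hq⟩ := hf
  obtain ⟨r, R, hr⟩ := hg
  refine ⟨fun b => .seq (dup (b + 0) (b + 1) (b + 2)) <| .seq (p (b + 1)) <| .case (b + 1) fun
      | some (Γ'.bit true) => .seq (mkPair b) (r b)
      | _ => .seq (.pop (b + 1)) (q b),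
    25 * Polynomial.X + 9 * P + Q + R.comp (Polynomial.X + P + 1) + 12, fun a => ?_⟩
  have hP := (hp a).1
  have hQ := (hq a).1
  have hstart : ∀ (b : ℕ) (s : Stacks) (br : Option Γ' → Prog) (y : List Γ') (t : ℕ),
      Exec (br (str (l a)).head?) (st s b [str a, str (l a)]) (st s b [y]) t →
      Exec (.seq (dup (b + 0) (b + 1) (b + 2)) <| .seq (p (b + 1)) <| .case (b + 1) br)
        (st s b [str a]) (st s b [y]) (9 * size a + P.eval (size a) + t + 3) := by
    intro b s br y t h
    have h1 : Exec (dup (b + 0) (b + 1) (b + 2)) (st s b [str a, [], []])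
        (st s b [str a, str a, []]) (9 * size a + 2) := by
      simpa [size] using exec_dup_st (s := s) (b := b) 0 1 2 [str a, [], []]
    have h2 : Exec (p (b + 1)) (st s b [str a, str a, []])
        (st s b [str a, str (l a), []]) (P.eval (size a)) :=
      exec_run (b := b) (s := s) (hp a).2 [str a] 1
    refine .of_pad 2 2 (.seq h1 (.seq h2 (.case (t₁ := t) ?_ le_rfl) le_rfl) (by omega))
    rw [st_apply]
    exact h.pad 1 2
  cases hla : l a with
  | nil =>
    simp only [hla]
    refine ⟨?_, fun b s => (hstart b s _ _ (1 + Q.eval (size a)) ?_).mono ?_⟩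
    · simp
      omega
    · rw [hla, str_nil, List.head?_cons]
      refine .seq ?_ ((hq a).2 b s) le_rfl
      exact .of_pad 0 1 (exec_pop_st 1 [str a, [Γ'.bit false]])
    · simp
      omega
  | cons x xs =>
    simp only [hla]
    have hsize : size (a, x, xs) = size a + size (l a) + 1 := by
      rw [size_pair, size_pair, hla, size_cons]
    have hR := hr (a, x, xs)
    have hR' := eval_mono R (show size (a, x, xs) ≤ size a + P.eval (size a) + 1 by omega)
    refine ⟨?_, fun b s => (hstart b s _ _ (16 * size a + 8 * size (l a) + 7 +
      R.eval (size (a, x, xs))) ?_).mono ?_⟩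
    · simp
      omega
    · have h1 : Exec (mkPair b) (st s b [str a, str (x :: xs)]) (st s b [str (a, x, xs)])
          (16 * size a + 8 * size (x :: xs) + 7) := exec_mkPair b s (str a) (str (x :: xs))
      rw [hla]
      exact .seq h1 (hR.2 b s) le_rfl
    · simp
      omega

/-- Iteration over a list, provided that all intermediate results are of polynomial size. -/
theorem PolyTime.foldl_of_bound {l : α → List β} {g : α → σ} {f : σ × β → σ} (hl : PolyTime l)
    (hg : PolyTime g) (hf : PolyTime f) (B : Polynomial ℕ)
    (hB : ∀ a l', l' <+: l a →
      size (l'.foldl (fun c x => f (c, x)) (g a)) ≤ B.eval (size a)) :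
    PolyTime (fun a => (l a).foldl (fun c x => f (c, x)) (g a)) := by
  have hf' : PolyTime (fun p : β × σ => f (p.2, p.1)) := hf.comp (.pair .snd .fst)
  obtain ⟨p, P, hp⟩ := hl
  obtain ⟨q, Q, hq⟩ := hg
  obtain ⟨r, R, hr⟩ := hf'
  -- In the loop, stack `b + 1` holds the rest of the list and stack `b + 2` the state. The next
  -- entry is put in front of the state, which makes a pair of the two, and the step is run on it.
  let L : ℕ → Prog := fun b => .loop (b + 1) (· == some (Γ'.bit true)) <|
    .seq (.pop (b + 1)) <| .seq (split (b + 1) (b + 3) (b + 4)) <|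
    .seq (rev (b + 3) (b + 2)) <| .seq (.push (b + 2) (Γ'.bit true)) (r (b + 2))
  refine ⟨fun b => .seq (dup (b + 0) (b + 1) (b + 2)) <| .seq (p (b + 1)) <|
    .seq (transfer (b + 0) (b + 2) (b + 3)) <| .seq (q (b + 2)) <| .seq (L b) <|
    .seq (.pop (b + 1)) (transfer (b + 2) (b + 0) (b + 3)),
    17 * Polynomial.X + P + Q + P * (9 * P + R.comp (P + B + 1) + 6) + 8 * B + 8, fun a => ?_⟩
  have hP := (hp a).1
  have hQ := (hq a).1
  have hloop : ∀ (b : ℕ) (s : Stacks) (l' : List β) (c : σ) (D : ℕ),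
      (∀ k, k <+: l' → size (k.foldl (fun c x => f (c, x)) c) ≤ D) →
      Exec (L b) (st s b [[], str l', str c, [], []])
        (st s b [[], str ([] : List β), str (l'.foldl (fun c x => f (c, x)) c), [], []])
        (l'.length * (9 * size l' + R.eval (size l' + D + 1) + 6) + 1) := by
    intro b s l'
    induction l' with
    | nil =>
      intro c D hD
      exact .loopDone (by rw [st_apply]; simp [str_nil]) (by simp)
    | cons x xs ih =>
      intro c D hD
      have h := ih (f (c, x)) D fun k hk => hD (x :: k) (List.prefix_cons_inj x |>.2 hk)
      have hc : size c ≤ D := hD [] (List.nil_prefix)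
      have hs := size_cons x xs
      have hsp := size_pair x c
      have hR1 : R.eval (size (x, c)) ≤ R.eval (size (x :: xs) + D + 1) := eval_mono R (by omega)
      have hR2 : R.eval (size xs + D + 1) ≤ R.eval (size (x :: xs) + D + 1) :=
        eval_mono R (by omega)
      have h1 : Exec (.pop (b + 1)) (st s b [[], str (x :: xs), str c, [], []])
          (st s b [[], str x ++ str xs, str c, [], []]) 1 :=
        exec_pop_st 1 [[], str (x :: xs), str c, [], []]
      have h2 : Exec (split (b + 1) (b + 3) (b + 4)) (st s b [[], str x ++ str xs, str c, [], []])
          (st s b [[], str xs, str c, (str x).reverse, []]) (5 * size x + 2) := by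
        have := exec_split_st (s := s) (b := b) 1 3 4 [[], str x ++ str xs, str c, [], []]
          (Code.code x) (str xs)
        simpa [← str.eq_1, size] using this
      have h3 : Exec (rev (b + 3) (b + 2)) (st s b [[], str xs, str c, (str x).reverse, []])
          (st s b [[], str xs, str x ++ str c, [], []]) (4 * size x + 1) := by
        simpa [size] using
          exec_rev_st (s := s) (b := b) 3 2 [[], str xs, str c, (str x).reverse, []]
      have h4 : Exec (.push (b + 2) (Γ'.bit true)) (st s b [[], str xs, str x ++ str c, [], []])
          (st s b [[], str xs, str (x, c), [], []]) 1 :=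
        exec_push_st 2 (Γ'.bit true) [[], str xs, str x ++ str c, [], []]
      have h5 : Exec (r (b + 2)) (st s b [[], str xs, str (x, c), [], []])
          (st s b [[], str xs, str (f (c, x)), [], []]) (R.eval (size (x, c))) :=
        exec_run (b := b) (s := s) (hr (x, c)).2 [[], str xs] 2
      refine .loopStep (by rw [st_apply]; simp [str_cons]) (.seq h1 (.seq h2 (.seq h3
        (.seq h4 h5 le_rfl) le_rfl) le_rfl) le_rfl) h ?_
      have : xs.length * (9 * size xs + R.eval (size xs + D + 1) + 6) ≤
          xs.length * (9 * size (x :: xs) + R.eval (size (x :: xs) + D + 1) + 6) :=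
        Nat.mul_le_mul_left _ (by omega)
      have h' := Nat.add_one_mul xs.length
        (9 * size (x :: xs) + R.eval (size (x :: xs) + D + 1) + 6)
      rw [List.length_cons]
      omega
  have hres := hB a (l a) List.prefix_rfl
  have hlen : (l a).length ≤ P.eval (size a) := (length_le_size _).trans hP
  have hmul := Nat.mul_le_mul hlen (show 9 * size (l a) +
    R.eval (size (l a) + B.eval (size a) + 1) + 6 ≤ 9 * P.eval (size a) +
    R.eval (P.eval (size a) + B.eval (size a) + 1) + 6 from by
      have := eval_mono R (show size (l a) + B.eval (size a) + 1 ≤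
        P.eval (size a) + B.eval (size a) + 1 by omega)
      omega)
  refine ⟨?_, fun b s => ?_⟩
  · simp
    omega
  set res := (l a).foldl (fun c x => f (c, x)) (g a) with hresdef
  have h1 : Exec (dup (b + 0) (b + 1) (b + 2)) (st s b [str a, [], [], [], []])
      (st s b [str a, str a, [], [], []]) (9 * size a + 2) := by
    simpa [size] using exec_dup_st (s := s) (b := b) 0 1 2 [str a, [], [], [], []]
  have h2 : Exec (p (b + 1)) (st s b [str a, str a, [], [], []])
      (st s b [str a, str (l a), [], [], []]) (P.eval (size a)) :=
    exec_run (b := b) (s := s) (hp a).2 [str a] 3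
  have h3 : Exec (transfer (b + 0) (b + 2) (b + 3)) (st s b [str a, str (l a), [], [], []])
      (st s b [[], str (l a), str a, [], []]) (8 * size a + 2) := by
    simpa [size] using exec_transfer_st (s := s) (b := b) 0 2 3 [str a, str (l a), [], [], []]
  have h4 : Exec (q (b + 2)) (st s b [[], str (l a), str a, [], []])
      (st s b [[], str (l a), str (g a), [], []]) (Q.eval (size a)) :=
    exec_run (b := b) (s := s) (hq a).2 [[], str (l a)] 2
  have h5 := hloop b s (l a) (g a) (B.eval (size a)) (hB a)
  rw [← hresdef] at h5
  have h6 : Exec (.pop (b + 1)) (st s b [[], str ([] : List β), str res, [], []])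
      (st s b [[], [], str res, [], []]) 1 :=
    exec_pop_st 1 [[], str ([] : List β), str res, [], []]
  have h7 : Exec (transfer (b + 2) (b + 0) (b + 3)) (st s b [[], [], str res, [], []])
      (st s b [str res, [], [], [], []]) (8 * size res + 2) := by
    simpa [size] using exec_transfer_st (s := s) (b := b) 2 0 3 [[], [], str res, [], []]
  refine .of_pad 4 4 (.seq h1 (.seq h2 (.seq h3 (.seq h4 (.seq h5 (.seq h6 h7 le_rfl) le_rfl)
    le_rfl) le_rfl) le_rfl) ?_)
  simp
  omega

end Closure

/-! ### A library of polynomial-time functions -/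

namespace PolyTime

variable {α β γ δ σ : Type} [Code α] [Code β] [Code γ] [Code δ] [Code σ]

theorem exists_bound {f : α → β} (hf : PolyTime f) :
    ∃ P : Polynomial ℕ, ∀ a, size (f a) ≤ P.eval (size a) :=
  let ⟨_, P, h⟩ := hf
  ⟨P, fun a => (h a).1⟩

/-- Only the representation of the result matters. -/
theorem congr_code {f : α → β} {g : α → γ} (hg : PolyTime g)
    (h : ∀ a, Code.code (f a) = Code.code (g a)) : PolyTime f := by
  obtain ⟨p, P, hp⟩ := hg
  have h' : ∀ a, str (f a) = str (g a) := fun a => congrArg BTree.str (h a)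
  refine ⟨p, P, fun a => ⟨?_, fun b s => ?_⟩⟩
  · rw [size, h']
    exact (hp a).1
  · rw [h']
    exact (hp a).2 b s

/-! #### Lists and truth values -/

theorem cons {x : α → β} {l : α → List β} (hx : PolyTime x) (hl : PolyTime l) :
    PolyTime (fun a => x a :: l a) :=
  (hx.pair hl).congr_code fun _ => rfl

/-- Case distinction on a list, with a curried second branch. -/
theorem list_elim {l : α → List β} {f : α → γ} {g : α → β → List β → γ} (hl : PolyTime l)
    (hf : PolyTime f) (hg : PolyTime (fun p : α × β × List β => g p.1 p.2.1 p.2.2)) :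
    PolyTime (fun a => match l a with
      | [] => f a
      | x :: xs => g a x xs) :=
  hl.listCase hf hg

theorem headD {l : α → List β} (d : β) (hl : PolyTime l) : PolyTime (fun a => (l a).headD d) := by
  convert hl.list_elim (g := fun _ x _ => x) (.const d) (.comp .fst .snd) using 2 with a
  cases l a <;> rfl

theorem tail {l : α → List β} (hl : PolyTime l) : PolyTime (fun a => (l a).tail) := by
  convert hl.list_elim (g := fun _ _ xs => xs) (.const []) (.comp .snd .snd) using 2 with a
  cases l a <;> rfl

theorem isEmpty {l : α → List β} (hl : PolyTime l) : PolyTime (fun a => (l a).isEmpty) := by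
  convert hl.list_elim (g := fun _ _ _ => false) (.const true) (.const false) using 2 with a
  cases l a <;> rfl

theorem ite {c : α → Bool} {f g : α → β} (hc : PolyTime c) (hf : PolyTime f) (hg : PolyTime g) :
    PolyTime (fun a => bif c a then f a else g a) := by
  have h : PolyTime (fun a => bif c a then [()] else []) := hc.congr_code fun a => by
    cases c a <;> rfl
  convert h.list_elim (g := fun a _ _ => f a) hg (hf.comp .fst) using 2 with a
  cases c a <;> rfl

theorem not {c : α → Bool} (hc : PolyTime c) : PolyTime (fun a => !c a) := by
  convert hc.ite (.const false) (.const true) using 2 with a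
  cases c a <;> rfl

theorem and {c d : α → Bool} (hc : PolyTime c) (hd : PolyTime d) :
    PolyTime (fun a => c a && d a) := by
  convert hc.ite hd (.const false) using 2 with a
  cases c a <;> rfl

theorem or {c d : α → Bool} (hc : PolyTime c) (hd : PolyTime d) :
    PolyTime (fun a => c a || d a) := by
  convert hc.ite (.const true) hd using 2 with a
  cases c a <;> rfl

theorem decide_not {p : α → Prop} [∀ a, Decidable (p a)] (hp : PolyTime (fun a => decide (p a))) :
    PolyTime (fun a => decide (¬p a)) := by
  simpa only [_root_.decide_not] using hp.not

theorem decide_and {p q : α → Prop} [∀ a, Decidable (p a)] [∀ a, Decidable (q a)]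
    (hp : PolyTime (fun a => decide (p a))) (hq : PolyTime (fun a => decide (q a))) :
    PolyTime (fun a => decide (p a ∧ q a)) := by
  simpa only [Bool.decide_and] using hp.and hq

theorem decide_or {p q : α → Prop} [∀ a, Decidable (p a)] [∀ a, Decidable (q a)]
    (hp : PolyTime (fun a => decide (p a))) (hq : PolyTime (fun a => decide (q a))) :
    PolyTime (fun a => decide (p a ∨ q a)) := by
  simpa only [Bool.decide_or] using hp.or hq

theorem decide_imp {p q : α → Prop} [∀ a, Decidable (p a)] [∀ a, Decidable (q a)]
    (hp : PolyTime (fun a => decide (p a))) (hq : PolyTime (fun a => decide (q a))) :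
    PolyTime (fun a => decide (p a → q a)) := by
  convert hp.decide_not.decide_or hq using 3
  exact imp_iff_not_or

theorem if_prop {p : α → Prop} [∀ a, Decidable (p a)] {f g : α → β}
    (hp : PolyTime (fun a => decide (p a))) (hf : PolyTime f) (hg : PolyTime g) :
    PolyTime (fun a => if p a then f a else g a) := by
  convert hp.ite hf hg using 2 with a
  by_cases h : p a <;> simp [h]

/-! #### Iteration -/

/-- Iteration over a list, where the step function has access to the input. -/
theorem foldl {l : α → List β} {g : α → σ} {f : α → σ → β → σ} (hl : PolyTime l) (hg : PolyTime g)
    (hf : PolyTime (fun p : α × σ × β => f p.1 p.2.1 p.2.2)) (B : Polynomial ℕ)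
    (hB : ∀ a l', l' <+: l a → size (l'.foldl (f a) (g a)) ≤ B.eval (size a)) :
    PolyTime (fun a => (l a).foldl (f a) (g a)) := by
  -- A copy of the input is carried along in the state.
  have key : ∀ (a : α) (l' : List β) (c : σ),
      l'.foldl (fun (c : α × σ) x => (c.1, f c.1 c.2 x)) (a, c) = (a, l'.foldl (f a) c) := by
    intro a l'
    induction l' with
    | nil => intro c; rfl
    | cons x l' ih => intro c; exact ih _
  have hf' : PolyTime (fun p : (α × σ) × β => (p.1.1, f p.1.1 p.1.2 p.2)) :=
    .pair (.comp .fst .fst) (hf.comp (.pair (.comp .fst .fst) (.pair (.comp .snd .fst) .snd)))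
  have h := PolyTime.snd.comp (foldl_of_bound hl (PolyTime.id.pair hg) hf'
    (Polynomial.X + B + 1) fun a l' hl' => by
      have := hB a l' hl'
      rw [key, size_pair]
      simp
      omega)
  simpa only [key] using h

/-- Iteration where every step enlarges the state by a polynomial amount only. -/
theorem foldl_of_add {l : α → List β} {g : α → σ} {f : α → σ → β → σ} (hl : PolyTime l)
    (hg : PolyTime g) (hf : PolyTime (fun p : α × σ × β => f p.1 p.2.1 p.2.2)) (Q : Polynomial ℕ)
    (hQ : ∀ a c x, x ∈ l a → size (f a c x) ≤ size c + Q.eval (size a)) :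
    PolyTime (fun a => (l a).foldl (f a) (g a)) := by
  obtain ⟨L, hL⟩ := hl.exists_bound
  obtain ⟨G, hG⟩ := hg.exists_bound
  have key : ∀ (a : α) (l' : List β) (c : σ), (∀ x ∈ l', x ∈ l a) →
      size (l'.foldl (f a) c) ≤ size c + l'.length * Q.eval (size a) := by
    intro a l'
    induction l' with
    | nil => intro c _; simp
    | cons x l' ih =>
      intro c hx
      have h1 := ih (f a c x) fun y hy => hx y (List.mem_cons_of_mem _ hy)
      have h2 := hQ a c x (hx x List.mem_cons_self)
      rw [List.foldl_cons, List.length_cons, Nat.add_one_mul]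
      omega
  refine hl.foldl hg hf (G + L * Q) fun a l' hl' => (key a l' (g a) fun x hx => hl'.subset hx).trans
    ?_
  have h1 : l'.length ≤ L.eval (size a) :=
    (hl'.length_le.trans (length_le_size _)).trans (hL a)
  rw [Polynomial.eval_add, Polynomial.eval_mul]
  exact add_le_add (hG a) (Nat.mul_le_mul_right _ h1)

theorem size_append (l l' : List β) : size (l ++ l') + 1 = size l + size l' := by
  induction l with
  | nil => simp [size_nil, add_comm]
  | cons x l ih => simp only [List.cons_append, size_cons]; omega

theorem size_reverse (l : List β) : size l.reverse = size l := by
  induction l with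
  | nil => rfl
  | cons x l ih =>
    have := size_append l.reverse [x]
    simp only [List.reverse_cons, size_cons, size_nil] at *
    omega

theorem size_bool_le (b : Bool) : size b ≤ 3 := by cases b <;> decide

theorem reverse {l : α → List β} (hl : PolyTime l) : PolyTime (fun a => (l a).reverse) := by
  obtain ⟨L, hL⟩ := hl.exists_bound
  convert hl.foldl_of_add (g := fun _ => []) (f := fun _ c x => x :: c) (.const [])
    (.cons (.comp .snd .snd) (.comp .fst .snd)) (L + 1) ?_ using 2 with a
  · simp
  · intro a c x hx
    have := (size_le_of_mem hx).trans (hL a)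
    rw [size_cons]
    simp
    omega

theorem foldr_of_add {l : α → List β} {g : α → σ} {f : α → β → σ → σ} (hl : PolyTime l)
    (hg : PolyTime g) (hf : PolyTime (fun p : α × β × σ => f p.1 p.2.1 p.2.2)) (Q : Polynomial ℕ)
    (hQ : ∀ a c x, x ∈ l a → size (f a x c) ≤ size c + Q.eval (size a)) :
    PolyTime (fun a => (l a).foldr (f a) (g a)) := by
  convert hl.reverse.foldl_of_add (f := fun a c x => f a x c) hg
    (hf.comp (.pair .fst (.pair (.comp .snd .snd) (.comp .fst .snd)))) Q
    (fun a c x hx => hQ a c x (by simpa using hx)) using 2 with a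
  simp

theorem map {l : α → List β} {f : α → β → γ} (hl : PolyTime l)
    (hf : PolyTime (fun p : α × β => f p.1 p.2)) : PolyTime (fun a => (l a).map (f a)) := by
  obtain ⟨L, hL⟩ := hl.exists_bound
  obtain ⟨F, hF⟩ := hf.exists_bound
  convert hl.foldr_of_add (g := fun _ => []) (f := fun a x c => f a x :: c) (.const [])
    (.cons (hf.comp (.pair .fst (.comp .fst .snd))) (.comp .snd .snd))
    (F.comp (Polynomial.X + L + 1) + 1) ?_ using 2 with a
  · simp
  · intro a c x hx
    have h1 := (size_le_of_mem hx).trans (hL a)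
    have h2 := hF (a, x)
    rw [size_pair] at h2
    have h3 := eval_mono F (show size a + size x + 1 ≤ size a + L.eval (size a) + 1 by omega)
    rw [size_cons]
    simp
    simp at h2
    omega

theorem append {l l' : α → List β} (hl : PolyTime l) (hl' : PolyTime l') :
    PolyTime (fun a => l a ++ l' a) := by
  obtain ⟨L, hL⟩ := hl.exists_bound
  convert hl.foldr_of_add (g := l') (f := fun _ x c => x :: c) hl'
    (.cons (.comp .fst .snd) (.comp .snd .snd)) (L + 1) ?_ using 2 with a
  · simp
  · intro a c x hx
    have := (size_le_of_mem hx).trans (hL a)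
    rw [size_cons]
    simp
    omega

theorem flatMap {l : α → List β} {f : α → β → List γ} (hl : PolyTime l)
    (hf : PolyTime (fun p : α × β => f p.1 p.2)) : PolyTime (fun a => (l a).flatMap (f a)) := by
  obtain ⟨L, hL⟩ := hl.exists_bound
  obtain ⟨F, hF⟩ := hf.exists_bound
  convert hl.foldr_of_add (g := fun _ => []) (f := fun a x c => f a x ++ c) (.const [])
    (.append (hf.comp (.pair .fst (.comp .fst .snd))) (.comp .snd .snd))
    (F.comp (Polynomial.X + L + 1)) ?_ using 2 with a
  · induction l a with
    | nil => rfl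
    | cons x l ih => simp [ih]
  · intro a c x hx
    have h1 := (size_le_of_mem hx).trans (hL a)
    have h2 := hF (a, x)
    rw [size_pair] at h2
    have h3 := eval_mono F (show size a + size x + 1 ≤ size a + L.eval (size a) + 1 by omega)
    have h4 := size_append (f a x) c
    simp
    simp at h2
    omega

theorem all {l : α → List β} {p : α → β → Prop} [∀ a x, Decidable (p a x)] (hl : PolyTime l)
    (hp : PolyTime (fun q : α × β => decide (p q.1 q.2))) :
    PolyTime (fun a => decide (∀ x ∈ l a, p a x)) := by
  convert hl.foldl (g := fun _ => true) (f := fun a c x => c && decide (p a x)) (.const true)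
    (.and (.comp .fst .snd) (hp.comp (.pair .fst (.comp .snd .snd)))) 3 ?_ using 2 with a
  · have : ∀ (l' : List β) (c : Bool), l'.foldl (fun c x => c && decide (p a x)) c =
        (c && decide (∀ x ∈ l', p a x)) := by
      intro l'
      induction l' with
      | nil => intro c; simp
      | cons x l' ih =>
        intro c
        rw [List.foldl_cons, ih]
        simp only [List.mem_cons, forall_eq_or_imp, Bool.decide_and, Bool.and_assoc]
    rw [this, Bool.true_and]
  · intro a l' _
    simpa using size_bool_le _

theorem any {l : α → List β} {p : α → β → Prop} [∀ a x, Decidable (p a x)] (hl : PolyTime l)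
    (hp : PolyTime (fun q : α × β => decide (p q.1 q.2))) :
    PolyTime (fun a => decide (∃ x ∈ l a, p a x)) := by
  convert (hl.all (p := fun a x => ¬p a x) hp.decide_not).decide_not using 3
  simp

end PolyTime

/-! ### Binary numbers -/

/-- The number with the given binary digits, most significant digit first. -/
def ofDigits (l : List Bool) : ℕ := l.foldl (fun n b => Nat.bit b n) 0

theorem size_bits_le (l : List Bool) : size l ≤ 4 * l.length + 1 := by
  induction l with
  | nil => simp [size_nil]
  | cons b l ih =>
    have := PolyTime.size_bool_le b
    rw [size_cons, List.length_cons]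
    omega

theorem size_nat_le (n : ℕ) : size n ≤ 4 * n.size + 1 := by
  rw [size_nat, ← Nat.size_eq_bits_len]
  exact size_bits_le _

theorem natSize_le_size (n : ℕ) : n.size ≤ size n := by
  rw [size_nat, ← Nat.size_eq_bits_len]
  exact length_le_size _

theorem size_nat_le_of_le {m n : ℕ} (h : m ≤ n) : size m ≤ 4 * n + 1 := by
  have h1 := size_nat_le m
  have h2 : m.size ≤ n := Nat.size_le.2 (h.trans_lt Nat.lt_two_pow_self)
  omega

theorem size_bit_le (b : Bool) (n : ℕ) : size (Nat.bit b n) ≤ size b + size n + 1 := by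
  by_cases h : n = 0 → b = true
  · rw [size_nat, Nat.bits_append_bit n b h, size_cons, ← size_nat]
  · push Not at h
    obtain ⟨rfl, hb⟩ := h
    cases b
    · simp [size_nat, size_nil]
    · exact absurd rfl hb

theorem natSize_add_le (m n : ℕ) : (m + n).size ≤ m.size + n.size := by
  rcases Nat.eq_zero_or_pos m with rfl | hm
  · simp
  rcases Nat.eq_zero_or_pos n with rfl | hn
  · simp
  rw [Nat.size_le]
  have h1 := Nat.lt_size_self m
  have h2 := Nat.lt_size_self n
  have h3 : 2 ≤ 2 ^ m.size := by
    calc 2 = 2 ^ 1 := rfl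
      _ ≤ 2 ^ m.size := Nat.pow_le_pow_right (by norm_num) (Nat.size_pos.2 hm)
  have h4 : 2 ≤ 2 ^ n.size := by
    calc 2 = 2 ^ 1 := rfl
      _ ≤ 2 ^ n.size := Nat.pow_le_pow_right (by norm_num) (Nat.size_pos.2 hn)
  rw [pow_add]
  nlinarith

theorem natSize_sum_le (l : List ℕ) : l.sum.size ≤ (l.map Nat.size).sum := by
  induction l with
  | nil => simp
  | cons n l ih =>
    rw [List.sum_cons, List.map_cons, List.sum_cons]
    exact (natSize_add_le _ _).trans (Nat.add_le_add_left ih _)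

/-- One step of the addition of binary numbers; the state consists of the remaining digits of both
summands, the carry bit, and the digits of the sum found so far, most significant digit first. -/
def addStep (c : ℕ × ℕ × Bool × List Bool) : ℕ × ℕ × Bool × List Bool :=
  (c.1.div2, c.2.1.div2,
    (c.1.bodd && c.2.1.bodd) || (c.2.2.1 && (c.1.bodd || c.2.1.bodd)),
    (bif c.1.bodd then (bif c.2.1.bodd then c.2.2.1 else !c.2.2.1)
      else (bif c.2.1.bodd then !c.2.2.1 else c.2.2.1)) :: c.2.2.2)

theorem addStep_sum (x y : ℕ) (c : Bool) (l : List Bool) :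
    x + y + c.toNat = Nat.bit ((addStep (x, y, c, l)).2.2.2.headD false)
      ((addStep (x, y, c, l)).1 + (addStep (x, y, c, l)).2.1 +
        (addStep (x, y, c, l)).2.2.1.toNat) := by
  have hx := Nat.bodd_add_div2 x
  have hy := Nat.bodd_add_div2 y
  simp only [addStep, List.headD_cons, Nat.bit_val]
  cases hbx : x.bodd <;> cases hby : y.bodd <;> cases c <;>
    simp [hbx, hby] at hx hy ⊢ <;> omega

/-- The list `l` only counts the steps; there have to be enough of them for all digits. -/
theorem foldl_addStep {β : Type} (l : List β) (x y : ℕ) (c : Bool) (o : List Bool)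
    (h : x + y + c.toNat < 2 ^ l.length) :
    ofDigits (l.foldl (fun c _ => addStep c) (x, y, c, o)).2.2.2 =
      o.foldl (fun n b => Nat.bit b n) (x + y + c.toNat) := by
  induction l generalizing x y c o with
  | nil =>
    have : x + y + c.toNat = 0 := by simpa using h
    simp [ofDigits, this]
  | cons a l ih =>
    have hs := addStep_sum x y c o
    rw [List.foldl_cons]
    have h2 : (addStep (x, y, c, o)).1 + (addStep (x, y, c, o)).2.1 +
        (addStep (x, y, c, o)).2.2.1.toNat < 2 ^ l.length := by
      rw [Nat.bit_val] at hs
      rw [List.length_cons, pow_succ] at h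
      omega
    have h3 := ih _ _ _ (addStep (x, y, c, o)).2.2.2 h2
    refine Eq.trans h3 ?_
    rw [hs]
    rfl

/-- One step of the comparison of binary numbers; the last component is the result for the digits
seen so far. -/
def leStep (c : ℕ × ℕ × Bool) : ℕ × ℕ × Bool :=
  (c.1.div2, c.2.1.div2,
    bif c.1.bodd then (c.2.1.bodd && c.2.2) else (c.2.1.bodd || c.2.2))

/-- The less significant digits only decide if the more significant ones, which come later, are
equal. -/
theorem foldl_leStep {β : Type} (l : List β) (x y : ℕ) (c : Bool)
    (hx : x < 2 ^ l.length) (hy : y < 2 ^ l.length) :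
    (l.foldl (fun c _ => leStep c) (x, y, c)).2.2 = decide (x < y ∨ (x = y ∧ c = true)) := by
  induction l generalizing x y c with
  | nil =>
    simp at hx hy
    simp [hx, hy]
  | cons a l ih =>
    rw [List.foldl_cons, leStep]
    have hx' := Nat.bodd_add_div2 x
    have hy' := Nat.bodd_add_div2 y
    rw [List.length_cons, pow_succ] at hx hy
    rw [ih _ _ _ (by simp only; omega) (by simp only; omega)]
    rw [decide_eq_decide]
    cases hbx : x.bodd <;> cases hby : y.bodd <;> cases c <;>
      simp [hbx, hby] at hx' hy' ⊢ <;> omega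

namespace PolyTime

variable {α β γ δ σ : Type} [Code α] [Code β] [Code γ] [Code δ] [Code σ]

theorem bits {f : α → ℕ} (hf : PolyTime f) : PolyTime (fun a => (f a).bits) :=
  hf.congr_code fun _ => rfl

theorem div2 {f : α → ℕ} (hf : PolyTime f) : PolyTime (fun a => (f a).div2) :=
  hf.bits.tail.congr_code fun a => by
    change Code.code (f a).div2.bits = _
    rw [Nat.div2_bits_eq_tail]

theorem bodd {f : α → ℕ} (hf : PolyTime f) : PolyTime (fun a => (f a).bodd) := by
  convert hf.bits.headD false using 2 with a
  rw [Nat.bodd_eq_bits_head]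
  cases (f a).bits <;> rfl

theorem bit {b : α → Bool} {f : α → ℕ} (hb : PolyTime b) (hf : PolyTime f) :
    PolyTime (fun a => Nat.bit (b a) (f a)) := by
  have h : PolyTime (fun a => bif b a then true :: (f a).bits else
      bif (f a).bits.isEmpty then [] else false :: (f a).bits) :=
    hb.ite (.cons (.const true) hf.bits)
      (.ite hf.bits.isEmpty (.const []) (.cons (.const false) hf.bits))
  refine h.congr_code fun a => ?_
  change Code.code (Nat.bit (b a) (f a)).bits = _
  congr 1
  cases hb : b a with
  | true => rw [Nat.bits_append_bit _ _ (fun _ => rfl)]; rfl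
  | false =>
    rcases Nat.eq_zero_or_pos (f a) with h0 | h0
    · simp [h0]
    · rw [Nat.bits_append_bit _ _ (fun h => absurd h h0.ne')]
      have : (f a).bits ≠ [] := fun h => by
        have := congrArg List.length h
        rw [Nat.size_eq_bits_len] at this
        exact absurd (Nat.size_eq_zero.1 this) h0.ne'
      cases h : (f a).bits with
      | nil => exact absurd h this
      | cons => rfl

theorem ofDigits {l : α → List Bool} (hl : PolyTime l) : PolyTime (fun a => ofDigits (l a)) :=
  hl.foldl_of_add (g := fun _ => 0) (f := fun _ n b => Nat.bit b n) (.const 0)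
    (.bit (.comp .snd .snd) (.comp .fst .snd)) 4 fun a n b _ => by
      have h1 := size_bit_le b n
      have h2 := size_bool_le b
      simp
      omega

theorem size_div2_le (n : ℕ) : size n.div2 ≤ size n := by
  rw [size_nat, size_nat, Nat.div2_bits_eq_tail]
  cases n.bits with
  | nil => exact le_rfl
  | cons b l => rw [List.tail_cons, size_cons]; omega

theorem add {f g : α → ℕ} (hf : PolyTime f) (hg : PolyTime g) : PolyTime (fun a => f a + g a) := by
  have hstep : PolyTime addStep := by
    have h1 : PolyTime (fun c : ℕ × ℕ × Bool × List Bool => c.1.bodd) := bodd .fst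
    have h2 : PolyTime (fun c : ℕ × ℕ × Bool × List Bool => c.2.1.bodd) := bodd (.comp .fst .snd)
    have h3 : PolyTime (fun c : ℕ × ℕ × Bool × List Bool => c.2.2.1) :=
      .comp .fst (.comp .snd .snd)
    exact .pair (div2 .fst) (.pair (div2 (.comp .fst .snd)) (.pair ((h1.and h2).or
      (h3.and (h1.or h2))) (.cons (h1.ite (h2.ite h3 h3.not) (h2.ite h3.not h3))
      (.comp .snd (.comp .snd .snd)))))
  -- The sum has at most one digit more than both summands together.
  -- The sum has at most one digit more than both summands together.
  -- The sum has at most one digit more than both summands together.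
  have h := ofDigits (.comp .snd (.comp .snd (.comp .snd ((PolyTime.cons
    (.const true) (hf.bits.append hg.bits)).foldl_of_add (g := fun a => (f a, g a, false, []))
    (f := fun _ c _ => addStep c) (.pair hf (.pair hg (.const (false, []))))
    (hstep.comp (.comp .fst .snd)) 8 ?_))))
  · convert h using 2 with a
    rw [foldl_addStep]
    · simp
    · have h1 := Nat.lt_size_self (f a)
      have h2 := Nat.lt_size_self (g a)
      have h3 := Nat.pow_le_pow_right (n := 2) (by norm_num)
        (Nat.le_add_right (f a).size (g a).size)
      have h4 := Nat.pow_le_pow_right (n := 2) (by norm_num) (Nat.le_add_left (g a).size (f a).size)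
      rw [List.length_cons, List.length_append, Nat.size_eq_bits_len, Nat.size_eq_bits_len,
        pow_succ]
      simp
      omega
  · rintro a ⟨x, y, c, o⟩ _ _
    have h1 := size_div2_le x
    have h2 := size_div2_le y
    have h3 := size_bool_le ((addStep (x, y, c, o)).2.2.1)
    have h4 := size_bool_le ((addStep (x, y, c, o)).2.2.2.headD false)
    have h5 := size_pos c
    simp only [addStep, size_pair, size_cons, List.headD_cons, Polynomial.eval_ofNat] at *
    omega

theorem decide_le {f g : α → ℕ} (hf : PolyTime f) (hg : PolyTime g) :
    PolyTime (fun a => decide (f a ≤ g a)) := by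
  have hstep : PolyTime leStep := by
    have h1 : PolyTime (fun c : ℕ × ℕ × Bool => c.1.bodd) := bodd .fst
    have h2 : PolyTime (fun c : ℕ × ℕ × Bool => c.2.1.bodd) := bodd (.comp .fst .snd)
    have h3 : PolyTime (fun c : ℕ × ℕ × Bool => c.2.2) := .comp .snd .snd
    exact .pair (div2 .fst) (.pair (div2 (.comp .fst .snd)) (h1.ite (h2.and h3) (h2.or h3)))
  have h := PolyTime.comp .snd (.comp .snd ((hf.bits.append hg.bits).foldl_of_add
    (g := fun a => (f a, g a, true))
    (f := fun _ c _ => leStep c) (.pair hf (.pair hg (.const true)))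
    (hstep.comp (.comp .fst .snd)) 2 ?_))
  · convert h using 2 with a
    rw [foldl_leStep]
    · simp [Nat.le_iff_lt_or_eq]
    · rw [List.length_append, Nat.size_eq_bits_len, Nat.size_eq_bits_len]
      exact (Nat.lt_size_self (f a)).trans_le
        (Nat.pow_le_pow_right (by norm_num) (Nat.le_add_right _ _))
    · rw [List.length_append, Nat.size_eq_bits_len, Nat.size_eq_bits_len]
      exact (Nat.lt_size_self (g a)).trans_le
        (Nat.pow_le_pow_right (by norm_num) (Nat.le_add_left _ _))
  · rintro a ⟨x, y, c⟩ _ _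
    have h1 := size_div2_le x
    have h2 := size_div2_le y
    have h3 := size_bool_le ((leStep (x, y, c)).2.2)
    have h5 := size_pos c
    simp only [leStep, size_pair, Polynomial.eval_ofNat] at *
    omega

theorem decide_lt {f g : α → ℕ} (hf : PolyTime f) (hg : PolyTime g) :
    PolyTime (fun a => decide (f a < g a)) := by
  convert (hg.decide_le hf).decide_not using 3
  exact Nat.not_le.symm

theorem decide_eq {f g : α → ℕ} (hf : PolyTime f) (hg : PolyTime g) :
    PolyTime (fun a => decide (f a = g a)) := by
  convert (hf.decide_le hg).decide_and (hg.decide_le hf) using 3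
  exact le_antisymm_iff

theorem sum {l : α → List ℕ} (hl : PolyTime l) : PolyTime (fun a => (l a).sum) := by
  obtain ⟨L, hL⟩ := hl.exists_bound
  convert hl.foldl (g := fun _ => 0) (f := fun _ c x => c + x) (.const 0)
    (.add (.comp .fst .snd) (.comp .snd .snd)) (4 * L + 1) ?_ using 2 with a
  · exact List.sum_eq_foldl
  · intro a l' hl'
    have h1 : ∀ l : List ℕ, (l.map Nat.size).sum ≤ size l := by
      intro l
      induction l with
      | nil => simp
      | cons n l ih =>
        have := natSize_le_size n
        rw [List.map_cons, List.sum_cons, size_cons]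
        omega
    have h2 := natSize_sum_le l'
    have h3 : (l'.map Nat.size).sum ≤ ((l a).map Nat.size).sum :=
      (hl'.sublist.map _).sum_le_sum fun _ _ => Nat.zero_le _
    have h4 := size_nat_le l'.sum
    have h5 := (h1 (l a)).trans (hL a)
    rw [← List.sum_eq_foldl]
    simp
    omega

theorem length {l : α → List β} (hl : PolyTime l) : PolyTime (fun a => (l a).length) := by
  convert (hl.map (f := fun _ _ => 1) (.const 1)).sum using 2 with a
  simp

/-- The index is found by a scan from the right, in which the count starts anew at every
occurrence. -/
theorem idxOf {l : α → List ℕ} {x : α → ℕ} (hx : PolyTime x) (hl : PolyTime l) :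
    PolyTime (fun a => (l a).idxOf (x a)) := by
  obtain ⟨L, hL⟩ := hl.exists_bound
  have key : ∀ (x : ℕ) (l : List ℕ),
      l.reverse.foldl (fun c y => if y = x then 0 else c + 1) 0 = l.idxOf x := by
    intro x l
    rw [List.foldl_reverse]
    induction l with
    | nil => rfl
    | cons y l ih => simp [List.idxOf_cons, ih, cond_eq_ite]
  convert hl.reverse.foldl (g := fun _ => 0) (f := fun a c y => if y = x a then 0 else c + 1)
    (.const 0) (.if_prop (.decide_eq (.comp .snd .snd) (hx.comp .fst)) (.const 0)
    (.add (.comp .fst .snd) (.const 1))) (4 * L + 1) ?_ using 2 with a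
  · exact (key _ _).symm
  · intro a l' hl'
    have h1 := hl'.length_le
    rw [← List.reverse_reverse l', key]
    have h2 := size_nat_le_of_le (List.idxOf_le_length (a := x a) (l := l'.reverse))
    have h3 := (length_le_size (l a)).trans (hL a)
    simp at h1 h2 ⊢
    omega

theorem mem {l : α → List ℕ} {x : α → ℕ} (hx : PolyTime x) (hl : PolyTime l) :
    PolyTime (fun a => decide (x a ∈ l a)) := by
  convert hl.any (p := fun a y => x a = y) (.decide_eq (hx.comp .fst) .snd) using 3
  simp

theorem decide_eq_range {l : α → List ℕ} (hl : PolyTime l) :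
    PolyTime (fun a => decide (l a = List.range (l a).length)) := by
  obtain ⟨L, hL⟩ := hl.exists_bound
  have key : ∀ (l : List ℕ) (b : Bool) (n : ℕ),
      l.foldl (fun c x => (c.1 && decide (x = c.2), c.2 + 1)) (b, n) =
        (b && decide (l = List.range' n l.length), n + l.length) := by
    intro l
    induction l with
    | nil => simp
    | cons x l ih =>
      intro b n
      rw [List.foldl_cons, ih]
      simp [List.range'_succ, Bool.and_assoc]
      omega
  convert PolyTime.fst.comp (hl.foldl (g := fun _ => (true, 0))
    (f := fun _ c x => (c.1 && decide (x = c.2), c.2 + 1)) (.const (true, 0))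
    (.pair (.and (.comp .fst (.comp .fst .snd)) (.decide_eq (.comp .snd .snd)
    (.comp .snd (.comp .fst .snd)))) (.add (.comp .snd (.comp .fst .snd)) (.const 1)))
    (4 * L + 5) ?_) using 2 with a
  · rw [key, Bool.true_and, List.range_eq_range']
  · intro a l' hl'
    rw [key, size_pair]
    have h1 := size_bool_le (true && decide (l' = List.range' 0 l'.length))
    have h2 := size_nat_le_of_le (Nat.le_refl (0 + l'.length))
    have h3 := hl'.length_le
    have h4 := (length_le_size (l a)).trans (hL a)
    simp at h1 h2 ⊢
    omega

end PolyTime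

/-! ### Input symbols, and the class P -/

/-- The number of an input symbol. -/
def symbolIndex : Γ' → ℕ
  | .blank => 0
  | .bit false => 1
  | .bit true => 2
  | .bra => 3
  | .ket => 4
  | .comma => 5

/-- Input symbols are represented by their number in unary. -/
instance : Code Γ' := ⟨fun x => Code.code (List.replicate (symbolIndex x) ())⟩

theorem size_symbol_le (x : Γ') : size x ≤ 11 := by
  revert x
  decide

namespace PolyTime

variable {α β γ δ σ : Type} [Code α] [Code β] [Code γ] [Code δ] [Code σ]

/-- Case distinction on a symbol. -/
theorem symbol_elim {x : α → Γ'} {f : Γ' → α → β} (hx : PolyTime x) (hf : ∀ s, PolyTime (f s)) :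
    PolyTime (fun a => f (x a) a) := by
  have hu : PolyTime (fun a => List.replicate (symbolIndex (x a)) ()) := hx.congr_code fun _ => rfl
  convert hu.isEmpty.ite (hf .blank) <| hu.tail.isEmpty.ite (hf (.bit false)) <|
    hu.tail.tail.isEmpty.ite (hf (.bit true)) <| hu.tail.tail.tail.isEmpty.ite (hf .bra) <|
    hu.tail.tail.tail.tail.isEmpty.ite (hf .ket) (hf .comma) using 2 with a
  rcases x a with _ | (_ | _) | _ | _ | _ <;> rfl

theorem decide_eq_symbol {x y : α → Γ'} (hx : PolyTime x) (hy : PolyTime y) :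
    PolyTime (fun a => decide (x a = y a)) :=
  hx.symbol_elim (f := fun s a => decide (s = y a)) fun s =>
    hy.symbol_elim (f := fun s' _ => decide (s = s')) fun _ => .const _

theorem decide_eq_list {x y : α → List Γ'} (hx : PolyTime x) (hy : PolyTime y) :
    PolyTime (fun a => decide (x a = y a)) := by
  let step (c : Bool × List Γ') (s : Γ') : Bool × List Γ' :=
    (c.1 && (!c.2.isEmpty && decide (c.2.headD .blank = s)), c.2.tail)
  have key : ∀ (l l' : List Γ') (b : Bool), ((l.foldl step (b, l')).1 &&
      (l.foldl step (b, l')).2.isEmpty) = (b && decide (l = l')) := by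
    intro l
    induction l with
    | nil => intro l' b; cases l' <;> simp
    | cons s l ih =>
      intro l' b
      rw [List.foldl_cons, ih]
      cases l' with
      | nil => simp
      | cons s' l' =>
        simp only [List.cons.injEq, Bool.decide_and, List.isEmpty_cons, List.headD_cons,
          List.tail_cons, Bool.not_false, Bool.true_and, Bool.and_assoc, eq_comm (a := s)]
        congr
  have hfold := hx.foldl_of_add (g := fun a => (true, y a)) (f := fun _ c s => step c s)
    (.pair (.const true) hy) (.pair (.and (.comp .fst (.comp .fst .snd))
      (.and (.not (.isEmpty (.comp .snd (.comp .fst .snd)))) (.decide_eq_symbol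
      (.headD Γ'.blank (.comp .snd (.comp .fst .snd))) (.comp .snd .snd))))
      (.tail (.comp .snd (.comp .fst .snd)))) 3 fun a c s _ => by
        have h1 := size_bool_le (c.1 && (!c.2.isEmpty && decide (c.2.headD .blank = s)))
        have h2 : size c.2.tail ≤ size c.2 := by
          cases c.2 with
          | nil => exact le_rfl
          | cons s l => rw [List.tail_cons, size_cons]; omega
        have h3 : size c = size c.1 + size c.2 + 1 := size_pair c.1 c.2
        simp only [step, size_pair, Polynomial.eval_ofNat]
        omega
  convert (PolyTime.fst.comp hfold).and (PolyTime.snd.comp hfold).isEmpty using 2 with a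
  rw [key, Bool.true_and]

end PolyTime

/-- Replaces an input word on stack `0` by its representation. -/
def loadInput : Prog :=
  .seq (.loop 0 Option.isSome <| .case 0 fun
    | none => .skip
    | some a => .seq (.pop 0) (pushAll 1 (Γ'.bit true :: str a).reverse)) <|
  .seq (.push 1 (Γ'.bit false)) (rev 1 0)

theorem size_word_le (w : List Γ') : size w ≤ 12 * w.length + 1 := by
  induction w with
  | nil => simp [size_nil]
  | cons a w ih =>
    have := size_symbol_le a
    rw [size_cons, List.length_cons]
    omega

theorem exec_loadInput (w : List Γ') :
    Exec loadInput (single w) (single (str w)) (68 * w.length + 8) := by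
  have hst : ∀ x, single x = st (fun _ => []) 0 [x, []] := by
    intro x
    funext k
    rcases k with _ | _ | k <;> simp [single, st]
  have key : ∀ (w A : List Γ'), Exec (.loop 0 Option.isSome <| .case 0 fun
      | none => .skip
      | some a => .seq (.pop 0) (pushAll 1 (Γ'.bit true :: str a).reverse))
      (st (fun _ => []) 0 [w, A])
      (st (fun _ => []) 0 [[], (str w).dropLast.reverse ++ A]) (16 * w.length + 1) := by
    intro w
    induction w with
    | nil => exact fun A => .loopDone (by simp [st]) (by simp)
    | cons a w ih =>
      intro A
      have h1 : Exec (.pop 0) (st (fun _ => []) 0 [a :: w, A]) (st (fun _ => []) 0 [w, A]) 1 :=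
        exec_pop_st (b := 0) 0 [a :: w, A]
      have h2 : Exec (pushAll 1 (Γ'.bit true :: str a).reverse) (st (fun _ => []) 0 [w, A])
          (st (fun _ => []) 0 [w, (Γ'.bit true :: str a).reverse ++ A]) 13 := by
        have h := exec_pushAll (0 + 1) (st (fun _ => []) 0 [w, A]) (Γ'.bit true :: str a).reverse
        rw [st_apply, update_st _ _ _ _ _ (by simp)] at h
        refine Exec.mono h ?_
        have : (str a).length ≤ 11 := size_symbol_le a
        simp
        omega
      have h3 := ih ((Γ'.bit true :: str a).reverse ++ A)
      have h4 : (str (a :: w)).dropLast.reverse ++ A =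
          (str w).dropLast.reverse ++ ((Γ'.bit true :: str a).reverse ++ A) := by
        have : str w ≠ [] := fun h => by
          have := size_pos w
          simp [size, h] at this
        rw [str_cons, ← List.cons_append, List.dropLast_append_of_ne_nil this]
        simp
      rw [h4]
      exact .loopStep (by simp [st]) (.case (t₁ := 14) (.seq h1 h2 le_rfl) le_rfl) h3
        (by rw [List.length_cons]; omega)
  have hlast : ∀ w : List Γ', (str w).dropLast ++ [Γ'.bit false] = str w := by
    intro w
    induction w with
    | nil => rfl
    | cons a w ih =>
      have : str w ≠ [] := fun h => by
        have := size_pos w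
        simp [size, h] at this
      rw [str_cons, ← List.cons_append, List.dropLast_append_of_ne_nil this, List.append_assoc, ih]
  have h1 := key w []
  have h2 : Exec (.push 1 (Γ'.bit false)) (st (fun _ => []) 0 [[], (str w).dropLast.reverse ++ []])
      (st (fun _ => []) 0 [[], (str w).reverse]) 1 := by
    have h := exec_push_st (s := fun _ => []) (b := 0) 1 (Γ'.bit false)
      [[], (str w).dropLast.reverse ++ []]
    have h3 := congrArg List.reverse (hlast w)
    simp only [List.reverse_append, List.reverse_singleton, List.singleton_append] at h3
    rw [← h3]
    simpa using h
  have h3 : Exec (rev 1 0) (st (fun _ => []) 0 [[], (str w).reverse])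
      (st (fun _ => []) 0 [str w, []]) (4 * size w + 1) := by
    simpa [size] using exec_rev_st (s := fun _ => []) (b := 0) 1 0 [[], (str w).reverse]
  rw [hst, hst]
  have := size_word_le w
  exact .seq h1 (.seq h2 h3 le_rfl) (by omega)

open Voting in
/-- A language with a decision procedure that is computable in polynomial time is in P. -/
theorem PolyTime.inP {L : Language Γ'} {f : List Γ' → Bool} (hf : PolyTime f)
    (hL : ∀ w, f w = true ↔ w ∈ L) : InP L := by
  classical
  obtain ⟨p, P, hp⟩ := hf
  obtain ⟨n, hn⟩ := (Prog.seq loadInput (p 0)).exists_fits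
  have hn := hn.mono (Nat.le_succ n)
  have hout : ∀ w : List Γ', Nonempty (TM2OutputsInTime (machine n (Prog.seq loadInput (p 0))) w
      (some [decide (w ∈ L)]) ((68 * Polynomial.X + 9 + P.comp (12 * Polynomial.X + 1)).eval
        w.length)) := by
    intro w
    have hst : ∀ x, single x = st (fun _ => []) 0 [x] := by
      intro x
      funext k
      rcases k with _ | k <;> simp [single, st]
    have h1 := (hp w).2 0 fun _ => []
    rw [← hst, ← hst] at h1
    have h2 := machine_outputs hn (.seq (exec_loadInput w) h1 le_rfl) (size_bool_le (f w))
    have h3 : decide ((str (f w)).head? = some (Γ'.bit true)) = decide (w ∈ L) := by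
      rw [decide_eq_decide, ← hL]
      cases f w <;> decide
    rw [h3] at h2
    obtain ⟨h2⟩ := h2
    refine ⟨⟨h2.1, h2.2.trans ?_⟩⟩
    have := eval_mono P (size_word_le w)
    simp
    omega
  refine ⟨{ tm := machine n (Prog.seq loadInput (p 0))
            inputAlphabet := Equiv.refl Γ'
            outputAlphabet := Equiv.refl Bool
            time := 68 * Polynomial.X + 9 + P.comp (12 * Polynomial.X + 1)
            outputsFun := fun w => cast ?_ (hout w).some }, ?_⟩
  · have h1 : List.map (Equiv.refl Γ').invFun (_root_.id w) = w := List.map_id w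
    exact congrArg (fun x => TM2OutputsInTime (machine n (Prog.seq loadInput (p 0))) x
      (some [decide (w ∈ L)]) ((68 * Polynomial.X + 9 + P.comp (12 * Polynomial.X + 1)).eval
        w.length)) h1.symm
  · rintro (_ | k)
    · exact inferInstanceAs (Finite Bool)
    · exact inferInstanceAs (Finite Γ')

end StackProg

namespace Voting

open Computability StackProg

/-! ### Parsing instances -/

theorem encodeBinary_eq_map_bits (n : ℕ) : encodeBinary n = n.bits.map Γ'.bit := by
  have h1 : ∀ p : PosNum, encodePosNum p = (p : ℕ).bits := by
    intro p
    induction p with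
    | one => simp [encodePosNum]
    | bit1 p ih => rw [encodePosNum, ih, PosNum.cast_bit1, ← two_mul, Nat.bit1_bits]
    | bit0 p ih =>
      rw [encodePosNum, ih, PosNum.cast_bit0, ← two_mul, Nat.bit0_bits _ (PosNum.cast_pos p).ne']
  have h2 : encodeNat n = n.bits := by
    conv_rhs => rw [← Num.to_of_nat n]
    rw [encodeNat]
    cases (n : Num) with
    | zero => simp [encodeNum]
    | pos p => exact h1 p
  exact congrArg (List.map Γ'.bit) h2

/-- The plain data of an instance: the list of the candidates, the weighted votes, each of them
as a list of candidates, the weights of the manipulators, and the distinguished candidate. Such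
data need not come from an instance. -/
abbrev RawInstance : Type := List ℕ × List (List ℕ × ℕ) × List ℕ × ℕ

namespace RawInstance

/-- The string that represents the plain data of an instance. -/
def encode (r : RawInstance) : List Γ' :=
  encodeListWith encodeBinary r.1 ++
    encodeListWith (fun v : List ℕ × ℕ => encodeListWith encodeBinary v.1 ++ encodeBinary v.2)
      r.2.1 ++
    encodeListWith encodeBinary r.2.2.1 ++ encodeBinary r.2.2.2

/-- The state of the parser: whether it is inside of an outer and of an inner pair of brackets,
the digits read since the last comma, the entries of the inner list read so far, the entries of
the outer list read so far, each of them consisting of an inner list and a number, and the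
completed outer lists. The latest entry comes first throughout. -/
abbrev ParseState : Type :=
  (Bool × Bool) × List Bool × List ℕ × List (List ℕ × ℕ) × List (List (List ℕ × ℕ))

/-- The parser reads one symbol. -/
def parseStep (s : ParseState) : Γ' → ParseState
  | .blank => s
  | .bit b => (s.1, b :: s.2.1, s.2.2)
  | .bra => ((true, s.1.1), s.2)
  | .ket => ((s.1.2, false), s.2.1, s.2.2.1,
      bif s.1.2 then s.2.2.2 else ([], s.2.2.2.1.reverse :: s.2.2.2.2))
  | .comma => (s.1, [],
      bif s.1.2 then (ofDigits s.2.1 :: s.2.2.1, s.2.2.2)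
      else ([], (s.2.2.1.reverse, ofDigits s.2.1) :: s.2.2.2.1, s.2.2.2.2))

/-- Recovers the plain data of an instance from the string that represents them. The value on
other strings does not matter. -/
def decode (w : List Γ') : RawInstance :=
  let s := w.foldl parseStep ((false, false), [], [], [], [])
  ((s.2.2.2.2.tail.tail.headD []).map Prod.snd, s.2.2.2.2.tail.headD [],
    (s.2.2.2.2.headD []).map Prod.snd, ofDigits s.2.1)

theorem ofDigits_reverse_bits (n : ℕ) : ofDigits n.bits.reverse = n := by
  rw [ofDigits, List.foldl_reverse]
  induction n using Nat.binaryRec' with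
  | zero => simp
  | bit b n h ih => rw [Nat.bits_append_bit n b h, List.foldr_cons, ih]

theorem foldl_parseStep_encodeBinary (n : ℕ) (s : ParseState) :
    (encodeBinary n).foldl parseStep s = (s.1, n.bits.reverse ++ s.2.1, s.2.2) := by
  rw [encodeBinary_eq_map_bits]
  generalize n.bits = l
  induction l generalizing s with
  | nil => rfl
  | cons b l ih =>
    rw [List.map_cons, List.foldl_cons, ih]
    simp [parseStep]

theorem foldl_parseStep_innerList (l : List ℕ) (sec : List (List ℕ × ℕ))
    (secs : List (List (List ℕ × ℕ))) :
    (encodeListWith encodeBinary l).foldl parseStep ((true, false), [], [], sec, secs) =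
      ((true, false), [], l.reverse, sec, secs) := by
  have key : ∀ l inner : List ℕ, (l.flatMap fun n => encodeBinary n ++ [Γ'.comma]).foldl parseStep
      ((true, true), [], inner, sec, secs) =
        ((true, true), [], l.reverse ++ inner, sec, secs) := by
    intro l
    induction l with
    | nil => intro inner; rfl
    | cons n l ih =>
      intro inner
      simp [foldl_parseStep_encodeBinary, parseStep, ofDigits_reverse_bits, ih]
  rw [encodeListWith, List.foldl_cons, List.foldl_append]
  change List.foldl parseStep (List.foldl parseStep ((true, true), [], [], sec, secs) _) _ = _
  rw [key]
  simp [parseStep]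

theorem foldl_parseStep_outerList {α : Type} (f : α → List Γ') (g : α → List ℕ × ℕ)
    (hf : ∀ x sec secs, (f x).foldl parseStep ((true, false), [], [], sec, secs) =
      ((true, false), (g x).2.bits.reverse, (g x).1.reverse, sec, secs))
    (l : List α) (secs : List (List (List ℕ × ℕ))) :
    (encodeListWith f l).foldl parseStep ((false, false), [], [], [], secs) =
      ((false, false), [], [], [], l.map g :: secs) := by
  have key : ∀ (l : List α) (sec : List (List ℕ × ℕ)),
      (l.flatMap fun x => f x ++ [Γ'.comma]).foldl parseStep
        ((true, false), [], [], sec, secs) =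
          ((true, false), [], [], (l.map g).reverse ++ sec, secs) := by
    intro l
    induction l with
    | nil => intro sec; rfl
    | cons x l ih =>
      intro sec
      simp [hf, parseStep, ofDigits_reverse_bits, ih]
  rw [encodeListWith, List.foldl_cons, List.foldl_append]
  change List.foldl parseStep (List.foldl parseStep ((true, false), [], [], [], secs) _) _ = _
  rw [key]
  simp [parseStep]

theorem decode_encode (r : RawInstance) : decode r.encode = r := by
  have h1 := foldl_parseStep_outerList encodeBinary (fun n => ([], n))
    (fun x sec secs => by simp [foldl_parseStep_encodeBinary])
  have h2 := foldl_parseStep_outerList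
    (fun v : List ℕ × ℕ => encodeListWith encodeBinary v.1 ++ encodeBinary v.2) id
    (fun x sec secs => by
      rw [List.foldl_append, foldl_parseStep_innerList, foldl_parseStep_encodeBinary]
      simp)
  have h3 : r.encode.foldl parseStep ((false, false), [], [], [], []) =
      ((false, false), r.2.2.2.bits.reverse, [], [],
        [r.2.2.1.map fun n => ([], n), r.2.1, r.1.map fun n => ([], n)]) := by
    rw [encode, List.foldl_append, List.foldl_append, List.foldl_append, h1, h2, h1,
      foldl_parseStep_encodeBinary]
    simp
  rw [decode, h3]
  simp [ofDigits_reverse_bits, Function.comp_def]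

/-! #### The parser runs in polynomial time -/

theorem size_ofDigits_le (l : List Bool) : size (ofDigits l) ≤ size l := by
  have key : ∀ (l : List Bool) (n : ℕ),
      size (l.foldl (fun n b => Nat.bit b n) n) + 1 ≤ size n + size l := by
    intro l
    induction l with
    | nil => intro n; rw [size_nil]; exact le_rfl
    | cons b l ih =>
      intro n
      have h1 := ih (Nat.bit b n)
      have h2 := size_bit_le b n
      rw [List.foldl_cons, size_cons]
      omega
  have h1 := key l 0
  have h2 : size 0 = 1 := by rw [size_nat, Nat.zero_bits, size_nil]
  rw [ofDigits]
  omega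

theorem polyTime_parseStep : PolyTime (fun p : ParseState × Γ' => parseStep p.1 p.2) := by
  have hs : PolyTime (fun p : ParseState × Γ' => p.1) := .fst
  have hsec : PolyTime (fun p : ParseState × Γ' => p.1.1.1) := .comp .fst (.comp .fst .fst)
  have hinner : PolyTime (fun p : ParseState × Γ' => p.1.1.2) := .comp .snd (.comp .fst .fst)
  have h1 : PolyTime (fun p : ParseState × Γ' => p.1.2) := .comp .snd .fst
  have h2 : PolyTime (fun p : ParseState × Γ' => p.1.2.2) := .comp .snd h1
  have h3 : PolyTime (fun p : ParseState × Γ' => p.1.2.2.2) := .comp .snd h2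
  refine PolyTime.symbol_elim (f := fun x (p : ParseState × Γ') => parseStep p.1 x) .snd fun x => ?_
  cases x with
  | blank => exact .fst
  | bit b => exact .pair (.comp .fst hs) (.pair (.cons (.const b) (.comp .fst h1)) h2)
  | bra => exact .pair (.pair (.const true) hsec) h1
  | ket =>
    exact .pair (.pair hinner (.const false)) (.pair (.comp .fst h1) (.pair (.comp .fst h2)
      (.ite hinner h3 (.pair (.const []) (.cons (.reverse (.comp .fst h3)) (.comp .snd h3))))))
  | comma =>
    exact .pair (.comp .fst hs) (.pair (.const []) (.ite hinner
      (.pair (.cons (.ofDigits (.comp .fst h1)) (.comp .fst h2)) h3)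
      (.pair (.const []) (.pair (.cons (.pair (.reverse (.comp .fst h2))
        (.ofDigits (.comp .fst h1))) (.comp .fst h3)) (.comp .snd h3)))))

theorem size_parseStep_le (s : ParseState) (x : Γ') : size (parseStep s x) ≤ size s + 10 := by
  obtain ⟨⟨b, b'⟩, bits, inner, sec, secs⟩ := s
  have h1 := size_ofDigits_le bits
  have h2 := PolyTime.size_bool_le b
  have h2' := PolyTime.size_bool_le b'
  have h3 : ∀ b : Bool, 1 ≤ size b := fun b => size_pos b
  have h4 := h3 b
  have h5 := h3 b'
  have ht : size true = 3 := by decide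
  have hf : size false = 1 := by decide
  cases x with
  | blank => simp [parseStep]
  | bit c =>
    have := PolyTime.size_bool_le c
    simp only [parseStep, size_pair, size_cons]
    omega
  | bra => simp only [parseStep, size_pair]; omega
  | ket => cases b' <;> simp only [parseStep, size_pair, size_cons, cond_true, cond_false,
      PolyTime.size_reverse, size_nil] <;> omega
  | comma => cases b' <;> simp only [parseStep, size_pair, size_cons, cond_true, cond_false,
      PolyTime.size_reverse, size_nil] <;> omega

theorem polyTime_decode : PolyTime decode := by
  have h : PolyTime (fun w : List Γ' => w.foldl parseStep ((false, false), [], [], [], [])) :=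
    PolyTime.id.foldl_of_add (f := fun _ s x => parseStep s x) (.const _)
      (polyTime_parseStep.comp .snd) 10 fun _ s x _ => by
        simpa using size_parseStep_le s x
  have hs := PolyTime.comp .snd (.comp .snd (.comp .snd (.comp .snd h)))
  exact .pair (.map (.headD [] (.tail (.tail hs))) (.comp .snd .snd)) (.pair (.headD [] (.tail hs))
    (.pair (.map (.headD [] hs) (.comp .snd .snd)) (.ofDigits (.comp .fst (.comp .snd h)))))

theorem polyTime_encodeListWith {α β : Type} [Code α] [Code β] {f : β → List Γ'}
    {l : α → List β} (hl : PolyTime l) (hf : PolyTime f) :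
    PolyTime (fun a => encodeListWith f (l a)) :=
  .cons (.const _) (.append (.flatMap hl (.append (hf.comp .snd) (.const _))) (.const _))

theorem polyTime_encodeBinary : PolyTime encodeBinary := by
  have hbit : PolyTime (fun p : ℕ × Bool => bif p.2 then Γ'.bit true else Γ'.bit false) :=
    .ite .snd (.const _) (.const _)
  convert PolyTime.map (f := fun _ b => bif b then Γ'.bit true else Γ'.bit false) (.bits .id) hbit
    using 2 with n
  rw [encodeBinary_eq_map_bits]
  congr
  funext b
  cases b <;> rfl

theorem polyTime_encode : PolyTime encode :=
  .append (.append (.append (polyTime_encodeListWith .fst polyTime_encodeBinary)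
    (polyTime_encodeListWith (.comp .fst .snd) (.append
      (polyTime_encodeListWith .fst polyTime_encodeBinary) (polyTime_encodeBinary.comp .snd))))
    (polyTime_encodeListWith (.comp .fst (.comp .snd .snd)) polyTime_encodeBinary))
    (polyTime_encodeBinary.comp (.comp .snd (.comp .snd .snd)))

end RawInstance

/-! ### The Skating System as a lexicographic comparison -/

namespace WeightedElection

variable {m : ℕ}

/-- What decides about `c` in stage `j`: a higher score is better, and among equal scores a lower
sum of positions is. -/
def key (V : WeightedElection m) (j : ℕ) (c : Fin m) : ℕ ×ₗ ℕᵒᵈ :=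
  toLex (V.score j c, OrderDual.toDual (V.sumpos j c))

theorem key_lt_key {V V' : WeightedElection m} {j j' : ℕ} {c d : Fin m} :
    V.key j c < V'.key j' d ↔ V.score j c < V'.score j' d ∨
      V.score j c = V'.score j' d ∧ V'.sumpos j' d < V.sumpos j c :=
  Prod.Lex.toLex_lt_toLex

theorem key_le_key {V V' : WeightedElection m} {j j' : ℕ} {c d : Fin m} :
    V.key j c ≤ V'.key j' d ↔ V.score j c < V'.score j' d ∨
      V.score j c = V'.score j' d ∧ V'.sumpos j' d ≤ V.sumpos j c :=
  Prod.Lex.toLex_le_toLex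

theorem score_le_of_key_le {V V' : WeightedElection m} {j j' : ℕ} {c d : Fin m}
    (h : V.key j c ≤ V'.key j' d) : V.score j c ≤ V'.score j' d := by
  rcases key_le_key.1 h with h | h
  exacts [h.le, h.1.le]

/-- From stage `j` on, the first stage in which `c` and `d` differ, if there is one, is in favor
of `d`. -/
def Withstands (V : WeightedElection m) (j : ℕ) (d c : Fin m) : Prop :=
  ∀ j', j ≤ j' → j' ≤ m → V.key j' d < V.key j' c → ∃ i, j ≤ i ∧ i < j' ∧ V.key i c < V.key i d

theorem withstands_iff {V : WeightedElection m} {j : ℕ} (hj : j ≤ m) {d c : Fin m} :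
    V.Withstands j d c ↔
      V.key j c < V.key j d ∨ V.key j c = V.key j d ∧ V.Withstands (j + 1) d c := by
  constructor
  · intro h
    rcases lt_trichotomy (V.key j c) (V.key j d) with h1 | h1 | h1
    · exact .inl h1
    · refine .inr ⟨h1, fun j' h2 h3 h4 => ?_⟩
      obtain ⟨i, h5, h6, h7⟩ := h j' (by omega) h3 h4
      refine ⟨i, ?_, h6, h7⟩
      rcases h5.eq_or_lt with rfl | h5
      · exact absurd h1 h7.ne
      · exact h5
    · obtain ⟨i, h5, h6, -⟩ := h j le_rfl hj h1
      omega
  · rintro (h | ⟨h, h'⟩) j' h2 h3 h4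
    · rcases h2.eq_or_lt with rfl | h2
      · exact absurd h4 h.not_gt
      · exact ⟨j, le_rfl, h2, h⟩
    · rcases h2.eq_or_lt with rfl | h2
      · exact absurd h.symm h4.ne
      · obtain ⟨i, h5, h6⟩ := h' j' h2 h3 h4
        exact ⟨i, by omega, h6⟩

theorem bestSumpos_bestScore (V : WeightedElection m) (j : ℕ) (C : Finset (Fin m)) :
    V.bestSumpos j (V.bestScore j C) = C.filter fun c => ∀ d ∈ C, V.key j d ≤ V.key j c := by
  ext x
  simp only [bestSumpos, bestScore, Finset.mem_filter, and_assoc, key_le_key]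
  refine and_congr_right fun hx => ⟨fun ⟨h1, h2⟩ d hd => ?_, fun h => ⟨fun d hd => ?_, ?_⟩⟩
  · rcases (h1 d hd).lt_or_eq with h3 | h3
    · exact .inl h3
    · exact .inr ⟨h3, h2 d ⟨hd, fun e he => h3 ▸ h1 e he⟩⟩
  · rcases h d hd with h | h
    exacts [h.le, h.1.le]
  · rintro d ⟨hd, h1⟩
    rcases h d hd with h | h
    · exact absurd (h1 x hx) (not_le.2 h)
    · exact h.2

/-- One stage keeps the candidates with the best key. It does not matter that a single candidate
with the highest score wins without a look at the sums of positions. -/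
theorem runStages_eq (V : WeightedElection m) (j : ℕ) {C : Finset (Fin m)} (hC : C.Nonempty) :
    V.runStages j C =
      if (C.filter fun c => ∀ d ∈ C, V.key j d ≤ V.key j c).card = 1 ∨ m ≤ j then
        C.filter fun c => ∀ d ∈ C, V.key j d ≤ V.key j c
      else V.runStages (j + 1) (C.filter fun c => ∀ d ∈ C, V.key j d ≤ V.key j c) := by
  have hne : (C.filter fun c => ∀ d ∈ C, V.key j d ≤ V.key j c).Nonempty := by
    obtain ⟨c, hc, h⟩ := C.exists_max_image (V.key j) hC
    exact ⟨c, Finset.mem_filter.2 ⟨hc, h⟩⟩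
  rw [runStages]
  simp only [bestSumpos_bestScore]
  by_cases h1 : (V.bestScore j C).card = 1
  · have hsub : (C.filter fun c => ∀ d ∈ C, V.key j d ≤ V.key j c) ⊆ V.bestScore j C := by
      rw [← bestSumpos_bestScore]
      exact Finset.filter_subset _ _
    have heq := Finset.eq_of_subset_of_card_le hsub (by
      rw [h1]
      exact hne.card_pos)
    rw [if_pos h1, heq, if_pos (.inl h1)]
  · rw [if_neg h1]
    split_ifs <;> tauto

theorem runStages_subset (V : WeightedElection m) (j : ℕ) {C : Finset (Fin m)}
    (hC : C.Nonempty) : V.runStages j C ⊆ C.filter fun c => ∀ d ∈ C, V.key j d ≤ V.key j c := by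
  have hne : (C.filter fun c => ∀ d ∈ C, V.key j d ≤ V.key j c).Nonempty := by
    obtain ⟨c, hc, h⟩ := C.exists_max_image (V.key j) hC
    exact ⟨c, Finset.mem_filter.2 ⟨hc, h⟩⟩
  rw [runStages_eq V j hC]
  split_ifs with h
  · exact subset_rfl
  · exact (V.runStages_subset (j + 1) hne).trans (Finset.filter_subset _ _)
termination_by m - j

/-- From stage `j` on, `c` wins alone if and only if it is the only lexicographic maximum of the
keys of the stages `j, …, m`. -/
theorem runStages_eq_singleton_iff (V : WeightedElection m) {j : ℕ} (hj : j ≤ m)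
    {C : Finset (Fin m)} {c : Fin m} (hc : c ∈ C) :
    V.runStages j C = {c} ↔ ∀ d ∈ C, d ≠ c → ¬V.Withstands j d c := by
  have hC : C.Nonempty := ⟨c, hc⟩
  set B := C.filter fun c => ∀ d ∈ C, V.key j d ≤ V.key j c with hB
  by_cases hcB : c ∈ B
  · have hlt : ∀ d ∈ C, d ∉ B → ¬V.Withstands j d c := by
      intro d hd hdB h
      have h1 := (Finset.mem_filter.1 hcB).2
      refine hdB (Finset.mem_filter.2 ⟨hd, fun e he => (h1 e he).trans ?_⟩)
      rcases (withstands_iff hj).1 h with h | h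
      exacts [h.le, h.1.le]
    have heq : ∀ d ∈ B, V.key j c = V.key j d := fun d hd =>
      le_antisymm ((Finset.mem_filter.1 hd).2 c hc)
        ((Finset.mem_filter.1 hcB).2 d (Finset.mem_filter.1 hd).1)
    rw [runStages_eq V j hC, ← hB]
    split_ifs with h
    · constructor
      · intro hBc d hd hdc
        refine hlt d hd ?_
        rwa [hBc, Finset.mem_singleton]
      · intro h'
        rcases h with h | h
        · obtain ⟨x, hx⟩ := Finset.card_eq_one.1 h
          rw [hx, Finset.mem_singleton] at hcB
          rw [hx, hcB]
        · refine Finset.eq_singleton_iff_unique_mem.2 ⟨hcB, fun d hd => ?_⟩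
          by_contra hdc
          refine h' d (Finset.mem_filter.1 hd).1 hdc ((withstands_iff hj).2 (.inr ⟨heq d hd, ?_⟩))
          intro j' h1 h2
          omega
    · push Not at h
      rw [V.runStages_eq_singleton_iff h.2 hcB]
      constructor
      · intro h1 d hd hdc h2
        by_cases hdB : d ∈ B
        · refine h1 d hdB hdc ?_
          rcases (withstands_iff hj).1 h2 with h3 | h3
          exacts [absurd (heq d hdB) h3.ne, h3.2]
        · exact hlt d hd hdB h2
      · exact fun h1 d hd hdc h2 => h1 d (Finset.mem_filter.1 hd).1 hdc
          ((withstands_iff hj).2 (.inr ⟨heq d hd, h2⟩))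
  · refine iff_of_false (fun h => hcB (V.runStages_subset j hC (by simp [h]))) fun h => ?_
    obtain ⟨d, hd, hmax⟩ := C.exists_max_image (V.key j) hC
    have hlt : V.key j c < V.key j d := by
      by_contra h1
      exact hcB (Finset.mem_filter.2 ⟨hc, fun e he => (hmax e he).trans (not_lt.1 h1)⟩)
    refine h d hd ?_ ((withstands_iff hj).2 (.inl hlt))
    rintro rfl
    exact lt_irrefl _ hlt
termination_by m - j

/-! ### The first stage -/

/-- The total weight of the votes. -/
def total (V : WeightedElection m) : ℕ := (V.map Prod.snd).sum

theorem pos_pos (v : Vote m) (c : Fin m) : 1 ≤ v.pos c := Nat.le_add_left 1 _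

theorem pos_le (v : Vote m) (c : Fin m) : v.pos c ≤ m := (v c).2

theorem score_le_total (V : WeightedElection m) (i : ℕ) (c : Fin m) : V.score i c ≤ V.total :=
  List.sum_le_sum fun p _ => by split_ifs <;> omega

theorem score_eq_total (V : WeightedElection m) {i : ℕ} (hi : m ≤ i) (c : Fin m) :
    V.score i c = V.total := by
  rw [score, total]
  congr 1
  exact List.map_congr_left fun p _ => if_pos ((pos_le p.1 c).trans hi)

theorem score_le_sumpos (V : WeightedElection m) (i : ℕ) (c : Fin m) :
    V.score i c ≤ V.sumpos i c :=
  List.sum_le_sum fun p _ => by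
    split_ifs
    · exact Nat.le_mul_of_pos_left _ (pos_pos p.1 c)
    · exact le_rfl

theorem sumpos_le_mul_score (V : WeightedElection m) (i : ℕ) (c : Fin m) :
    V.sumpos i c ≤ m * V.score i c := by
  rw [score, ← List.sum_map_mul_left]
  refine List.sum_le_sum fun p _ => ?_
  split_ifs
  · exact Nat.mul_le_mul_right _ (pos_le p.1 c)
  · exact Nat.zero_le _

theorem firstStage_spec {V : WeightedElection m} {i : ℕ} {c : Fin m} (hi : 1 ≤ i) (hi' : i ≤ m)
    (h : V.maj ≤ V.score i c) :
    V.firstStage ≤ i ∧ 1 ≤ V.firstStage ∧ (∃ d, V.maj ≤ V.score V.firstStage d) ∧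
      ∀ i', 1 ≤ i' → i' < V.firstStage → ∀ d, V.score i' d < V.maj := by
  cases hf : (List.range' 1 m).find? fun i => decide (∃ c, V.maj ≤ V.score i c) with
  | none =>
    have := List.find?_eq_none.1 hf i (List.mem_range'_1.2 ⟨hi, by omega⟩)
    simp only [decide_eq_true_eq] at this
    exact absurd ⟨c, h⟩ this
  | some k =>
    have hk : V.firstStage = k := by rw [firstStage, hf, Option.getD_some]
    rw [List.find?_range'_eq_some] at hf
    simp only [decide_eq_true_eq, List.mem_range'_1, Bool.not_eq_true', decide_eq_false_iff_not,
      not_exists, not_le] at hf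
    obtain ⟨h1, ⟨h2, h3⟩, h4⟩ := hf
    rw [hk]
    refine ⟨?_, h2, h1, fun i' h5 h6 d => h4 i' h5 h6 d⟩
    by_contra h5
    exact absurd (h4 i hi (by omega) c) (not_lt.2 h)

theorem firstStage_le (V : WeightedElection m) : V.firstStage ≤ m := by
  rw [firstStage]
  cases hf : (List.range' 1 m).find? fun i => decide (∃ c, V.maj ≤ V.score i c) with
  | none => exact le_rfl
  | some k =>
    have := List.mem_range'_1.1 (List.mem_of_find?_eq_some hf)
    rw [Option.getD_some]
    omega

/-- A certificate for `c` not being the unique winner: the candidate `d` has a majority in some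
stage `i` before which `c` has none, and `d` is not behind `c` from stage `i` on. In contrast to
the rule itself this does not mention the first stage in which anyone has a majority, so that it
is monotone in the performance of `d` and antitone in that of `c`. -/
def Spoils (V : WeightedElection m) (d c : Fin m) : Prop :=
  V.total = 0 ∨ ∃ i, 1 ≤ i ∧ i ≤ m ∧ V.maj ≤ V.score i d ∧
    (∀ i', 1 ≤ i' → i' < i → V.score i' c < V.maj) ∧ V.Withstands i d c

theorem maj_le_total {V : WeightedElection m} (h : V.total ≠ 0) : V.maj ≤ V.total := by
  rw [maj, total] at *
  omega

/-- Whenever `c` is not the unique winner, some candidate is a certificate for that. In the first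
stage in which anyone has a majority, either the candidate that `c` does not beat has one, too, or
another one who has a majority is ahead of `c`. -/
theorem sks_ne_singleton_iff (V : WeightedElection m) (c : Fin m) :
    SkS m V ≠ {c} ↔ ∃ d, d ≠ c ∧ V.Spoils d c := by
  have hlex := V.runStages_eq_singleton_iff V.firstStage_le (Finset.mem_univ c)
  rw [SkS, Ne, hlex]
  push Not
  constructor
  · rintro ⟨d, -, hdc, h⟩
    by_cases h0 : V.total = 0
    · exact ⟨d, hdc, .inl h0⟩
    have hm : 1 ≤ m := c.pos
    obtain ⟨h1, h2, ⟨x, h3⟩, h4⟩ := firstStage_spec hm le_rfl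
      (c := c) ((maj_le_total h0).trans_eq (V.score_eq_total le_rfl c).symm)
    -- If `d` has no majority, neither has `c`, and a candidate `x` with a majority is ahead of `c`.
    by_cases hd : V.maj ≤ V.score V.firstStage d
    · exact ⟨d, hdc, .inr ⟨_, h2, h1, hd, fun i' h5 h6 => h4 i' h5 h6 c, h⟩⟩
    · have hcd : V.key V.firstStage c ≤ V.key V.firstStage d := by
        rcases (withstands_iff h1).1 h with h | h
        exacts [h.le, h.1.le]
      have hcx : V.score V.firstStage c < V.score V.firstStage x :=
        ((score_le_of_key_le hcd).trans_lt (not_le.1 hd)).trans_le h3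
      refine ⟨x, ?_, .inr ⟨_, h2, h1, h3, fun i' h5 h6 => h4 i' h5 h6 c, ?_⟩⟩
      · rintro rfl
        exact lt_irrefl _ hcx
      · exact (withstands_iff h1).2 (.inl (key_lt_key.2 (.inl hcx)))
  · rintro ⟨d, hdc, h0 | ⟨i, hi, him, hd, hc, h⟩⟩
    · refine ⟨d, Finset.mem_univ d, hdc, fun j' _ _ hlt => absurd hlt (not_lt.2 (le_of_eq ?_))⟩
      have hs : ∀ x, V.score j' x = 0 := fun x =>
        Nat.eq_zero_of_le_zero (h0 ▸ V.score_le_total j' x)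
      have hp : ∀ x, V.sumpos j' x = 0 := fun x => by
        have := V.sumpos_le_mul_score j' x
        rw [hs] at this
        omega
      rw [key, key, hs, hs, hp, hp]
    · obtain ⟨h1, h2, ⟨x, h3⟩, h4⟩ := firstStage_spec hi him hd
      -- If someone has a majority before stage `i`, then `c` is behind in that stage.
      rcases h1.eq_or_lt with h5 | h5
      · exact ⟨d, Finset.mem_univ d, hdc, h5 ▸ h⟩
      · have hcx := (hc _ h2 h5).trans_le h3
        refine ⟨x, Finset.mem_univ x, ?_,
          (withstands_iff (h1.trans him)).2 (.inl (key_lt_key.2 (.inl hcx)))⟩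
        rintro rfl
        exact lt_irrefl _ hcx

theorem Spoils.mono {V V' : WeightedElection m} {d c : Fin m} (h : V.Spoils d c)
    (ht : V.total = V'.total) (hd : ∀ i, 1 ≤ i → V.key i d ≤ V'.key i d)
    (hc : ∀ i, 1 ≤ i → V'.key i c ≤ V.key i c) : V'.Spoils d c := by
  have hmaj : V.maj = V'.maj := congrArg (fun t => t / 2 + 1) ht
  rcases h with h | ⟨i, hi, him, h1, h2, h3⟩
  · exact .inl (ht ▸ h)
  · refine .inr ⟨i, hi, him, hmaj ▸ h1.trans (score_le_of_key_le (hd i hi)), fun i' h4 h5 =>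
      hmaj ▸ (score_le_of_key_le (hc i' h4)).trans_lt (h2 i' h4 h5), fun j' h4 h5 h6 => ?_⟩
    obtain ⟨k, h7, h8, h9⟩ := h3 j' h4 h5
      (((hd j' (by omega)).trans_lt h6).trans_le (hc j' (by omega)))
    exact ⟨k, h7, h8, ((hc k (by omega)).trans_lt h9).trans_le (hd k (by omega))⟩

/-! ### The most harmful manipulation -/

theorem total_append (V V' : WeightedElection m) : (V ++ V').total = V.total + V'.total := by
  simp [total]

theorem score_append (V V' : WeightedElection m) (i : ℕ) (c : Fin m) :
    (V ++ V').score i c = V.score i c + V'.score i c := by simp [score]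

theorem sumpos_append (V V' : WeightedElection m) (i : ℕ) (c : Fin m) :
    (V ++ V').sumpos i c = V.sumpos i c + V'.sumpos i c := by simp [sumpos]

theorem total_zip (S : List (Vote m)) (W : List ℕ) (h : S.length = W.length) :
    total (S.zip W) = W.sum := by
  rw [total, List.map_snd_zip h.ge]

/-- All manipulators cast the vote `u`. -/
def bloc (u : Vote m) (W : List ℕ) : WeightedElection m := (List.replicate W.length u).zip W

theorem total_bloc (u : Vote m) (W : List ℕ) : (bloc u W).total = W.sum :=
  total_zip _ _ (by simp)

theorem score_bloc (u : Vote m) (W : List ℕ) (i : ℕ) (c : Fin m) :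
    (bloc u W).score i c = if u.pos c ≤ i then W.sum else 0 := by
  induction W with
  | nil => simp [bloc, score]
  | cons w W ih =>
    rw [bloc, score] at *
    simp only [List.length_cons, List.replicate_succ, List.zip_cons_cons, List.map_cons,
      List.sum_cons, ih]
    split_ifs <;> rfl

theorem sumpos_bloc (u : Vote m) (W : List ℕ) (i : ℕ) (c : Fin m) :
    (bloc u W).sumpos i c = if u.pos c ≤ i then u.pos c * W.sum else 0 := by
  induction W with
  | nil => simp [bloc, sumpos]
  | cons w W ih =>
    rw [bloc, sumpos] at *
    simp only [List.length_cons, List.replicate_succ, List.zip_cons_cons, List.map_cons,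
      List.sum_cons, ih]
    split_ifs
    · rw [Nat.mul_add]
    · rfl

theorem exists_vote {d c : Fin m} (h : d ≠ c) : ∃ u : Vote m, u.pos d = 1 ∧ u.pos c = m := by
  have hm : 2 ≤ m := by
    have h1 := d.2
    have h2 := c.2
    have h3 := Fin.val_ne_of_ne h
    omega
  let e := Equiv.swap d ⟨0, by omega⟩
  have h1 : e d = ⟨0, by omega⟩ := Equiv.swap_apply_left _ _
  have h2 : (⟨0, by omega⟩ : Fin m) ≠ e c := fun h' => h (e.injective (h1.trans h'))
  refine ⟨e.trans (Equiv.swap (e c) ⟨m - 1, by omega⟩), ?_, ?_⟩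
  · rw [Vote.pos, Equiv.trans_apply, h1, Equiv.swap_apply_of_ne_of_ne h2]
    rw [Ne, Fin.mk.injEq]
    omega
  · rw [Vote.pos, Equiv.trans_apply, Equiv.swap_apply_left]
    exact Nat.sub_add_cancel (by omega)

/-- No votes of the manipulators are better for `d` than to rank `d` first. -/
theorem key_le_key_bloc (V : WeightedElection m) {S : List (Vote m)} {W : List ℕ}
    (hS : S.length = W.length) {d : Fin m} {u : Vote m} (hd : u.pos d = 1) {i : ℕ} (hi : 1 ≤ i) :
    (V ++ S.zip W).key i d ≤ (V ++ bloc u W).key i d := by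
  have h1 := score_le_total (S.zip W) i d
  have h2 := score_le_sumpos (S.zip W) i d
  rw [total_zip S W hS] at h1
  rw [key_le_key]
  simp only [score_append, sumpos_append, score_bloc, sumpos_bloc, hd, hi, if_true]
  omega

/-- No votes of the manipulators are worse for `c` than to rank `c` last. -/
theorem key_bloc_le_key (V : WeightedElection m) {S : List (Vote m)} {W : List ℕ}
    (hS : S.length = W.length) {c : Fin m} {u : Vote m} (hc : u.pos c = m) (i : ℕ) :
    (V ++ bloc u W).key i c ≤ (V ++ S.zip W).key i c := by
  have h1 := sumpos_le_mul_score (S.zip W) i c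
  rw [key_le_key]
  simp only [score_append, sumpos_append, score_bloc, sumpos_bloc, hc]
  split_ifs with h
  · rw [score_eq_total (S.zip W) h, total_zip S W hS] at *
    omega
  · rcases Nat.eq_zero_or_pos (score (S.zip W) i c) with h2 | h2
    · rw [h2] at h1
      omega
    · omega

end WeightedElection

open WeightedElection

/-- The manipulators succeed if and only if they do so by a common vote that ranks some other
candidate first and the distinguished candidate last. -/
theorem destructiveSuccess_sks_iff (I : ManipulationInstance) :
    DestructiveSuccess SkS I ↔ ∃ (d : Fin I.numCand) (u : Vote I.numCand), d ≠ I.target ∧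
      u.pos d = 1 ∧ u.pos I.target = I.numCand ∧
        (I.votes ++ bloc u I.manipWeights).Spoils d I.target := by
  constructor
  · rintro ⟨S, hS, h⟩
    obtain ⟨d, hdc, h⟩ := (sks_ne_singleton_iff _ _).1 h
    obtain ⟨u, hd, hc⟩ := exists_vote hdc
    refine ⟨d, u, hdc, hd, hc, h.mono ?_ (fun i hi => key_le_key_bloc _ hS hd hi)
      (fun i _ => key_bloc_le_key _ hS hc i)⟩
    rw [total_append, total_append, total_bloc, total_zip S _ hS]
  · rintro ⟨d, u, hdc, hd, hc, h⟩
    exact ⟨_, by simp, (sks_ne_singleton_iff _ _).2 ⟨d, hdc, h⟩⟩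

/-! ### Sums of positions without multiplication -/

namespace WeightedElection

variable {m : ℕ}

/-- A candidate in position `p ≤ i` of a vote is counted in the `i + 1 - p` scores of the stages
`p, …, i`. -/
theorem sum_score_add_sumpos (V : WeightedElection m) (i : ℕ) (c : Fin m) :
    ∑ j ∈ Finset.range i, V.score (j + 1) c + V.sumpos i c = (i + 1) * V.score i c := by
  induction V with
  | nil => simp [score, sumpos]
  | cons p V ih =>
    have key : ∀ i, ∑ j ∈ Finset.range i, (if p.1.pos c ≤ j + 1 then p.2 else 0) +
        (if p.1.pos c ≤ i then p.1.pos c * p.2 else 0) =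
          (i + 1) * if p.1.pos c ≤ i then p.2 else 0 := by
      intro i
      have hpos := pos_pos p.1 c
      induction i with
      | zero => simp [show p.1.pos c ≠ 0 by omega]
      | succ i ih =>
        rw [Finset.sum_range_succ]
        rcases lt_trichotomy (p.1.pos c) (i + 1) with h | h | h
        · rw [if_pos (by omega), if_pos (by omega)] at ih
          rw [if_pos (by omega), if_pos (by omega), Nat.add_mul (i + 1) 1]
          omega
        · rw [if_neg (by omega), if_neg (by omega)] at ih
          rw [if_pos (by omega), if_pos (by omega), Nat.add_mul (i + 1) 1, ← h]
          omega
        · rw [if_neg (by omega), if_neg (by omega)] at ih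
          rw [if_neg (by omega), if_neg (by omega)]
          omega
    have hk := key i
    simp only [score, sumpos, List.map_cons, List.sum_cons, Finset.sum_add_distrib,
      Nat.mul_add] at ih ⊢
    omega

theorem key_lt_key_iff_sum_score {V : WeightedElection m} {i : ℕ} {c d : Fin m} :
    V.key i c < V.key i d ↔ V.score i c < V.score i d ∨ V.score i c = V.score i d ∧
      ∑ j ∈ Finset.range i, V.score (j + 1) c < ∑ j ∈ Finset.range i, V.score (j + 1) d := by
  rw [key_lt_key]
  refine or_congr_right (and_congr_right fun h => ?_)
  have h1 := V.sum_score_add_sumpos i c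
  have h2 := V.sum_score_add_sumpos i d
  rw [h] at h1
  omega

end WeightedElection

/-! ### Deciding plain instances -/

/-- The plain data of an instance. -/
def ManipulationInstance.raw (I : ManipulationInstance) : RawInstance :=
  (List.range I.numCand, I.votes.map fun p => (p.1.ranking.map Fin.val, p.2), I.manipWeights,
    I.target)

namespace RawInstance

/-- Whether plain data come from an instance. -/
def Valid (r : RawInstance) : Prop :=
  r.1 = List.range r.1.length ∧ (∀ v ∈ r.2.1, v.1.length = r.1.length ∧ ∀ x ∈ r.1, x ∈ v.1) ∧
    r.2.2.2 ∈ r.1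

/-- The total weight of the nonmanipulative votes that rank `x` among their top `k + 1`
positions. -/
def voteScore (r : RawInstance) (k x : ℕ) : ℕ :=
  (r.2.1.map fun v => if v.1.idxOf x ≤ k then v.2 else 0).sum

/-- The score of `d` in stage `k + 1` if all manipulators rank `d` first. -/
def topScore (r : RawInstance) (d k : ℕ) : ℕ := r.voteScore k d + r.2.2.1.sum

/-- The score of the distinguished candidate in stage `k + 1` if all manipulators rank it last. -/
def targetScore (r : RawInstance) (k : ℕ) : ℕ :=
  r.voteScore k r.2.2.2 + if k + 1 = r.1.length then r.2.2.1.sum else 0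

/-- The sum of the scores `s` of the stages up to `k + 1`. -/
def scoreSum (r : RawInstance) (s : ℕ → ℕ) (k : ℕ) : ℕ :=
  (r.1.map fun j => if j ≤ k then s j else 0).sum

/-- A candidate with the scores `s'` beats one with the scores `s` in stage `k + 1`. -/
def Behind (r : RawInstance) (s s' : ℕ → ℕ) (k : ℕ) : Prop :=
  s k < s' k ∨ s k = s' k ∧ r.scoreSum s k < r.scoreSum s' k

/-- The total weight of all votes. -/
def total (r : RawInstance) : ℕ := (r.2.1.map Prod.snd).sum + r.2.2.1.sum

/-- `WeightedElection.Spoils` for the common vote of the manipulators that ranks `d` first and the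
distinguished candidate last, with the stages counted from `0`. -/
def Spoils (r : RawInstance) (d : ℕ) : Prop :=
  r.total = 0 ∨ ∃ k ∈ r.1, r.total.div2 < r.topScore d k ∧
    (∀ j ∈ r.1, j < k → r.targetScore j ≤ r.total.div2) ∧
    ∀ j ∈ r.1, k ≤ j → r.Behind (r.topScore d) r.targetScore j →
      ∃ i ∈ r.1, k ≤ i ∧ i < j ∧ r.Behind r.targetScore (r.topScore d) i

/-- The manipulators succeed. -/
def Success (r : RawInstance) : Prop := ∃ d ∈ r.1, d ≠ r.2.2.2 ∧ r.Spoils d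

theorem valid_raw (I : ManipulationInstance) : I.raw.Valid := by
  refine ⟨by simp [ManipulationInstance.raw], ?_, by simp [ManipulationInstance.raw]⟩
  simp only [ManipulationInstance.raw, List.mem_map, forall_exists_index, and_imp, List.mem_range,
    List.length_range]
  rintro _ p hp rfl
  refine ⟨by simp [Vote.ranking], fun x hx => List.mem_map.2 ⟨⟨x, hx⟩, ?_, rfl⟩⟩
  exact List.mem_ofFn.2 ⟨p.1 ⟨x, hx⟩, p.1.symm_apply_apply _⟩

theorem Valid.exists_raw_eq {r : RawInstance} (h : r.Valid) :
    ∃ I : ManipulationInstance, I.raw = r := by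
  obtain ⟨cands, votes, weights, t⟩ := r
  obtain ⟨h1, h2, h3⟩ := h
  simp only at h1 h2 h3
  generalize cands.length = m at *
  subst h1
  have hvote : ∀ v ∈ votes, ∃ u : Vote m, u.ranking.map Fin.val = v.1 := by
    rintro ⟨l, w⟩ hv
    obtain ⟨hl, hmem⟩ := h2 _ hv
    simp only at hl hmem
    -- A list of `m` entries that contains all numbers below `m` is a permutation of them.
    have hsub : (List.range m) ⊆ l := fun x hx => hmem x hx
    have hperm : (List.range m).Perm l :=
      (List.subperm_of_subset List.nodup_range hsub).perm_of_length_le (by simp [hl])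
    have hnodup : l.Nodup := hperm.nodup List.nodup_range
    have hlt : ∀ i : Fin m, l[i] < m := fun i =>
      List.mem_range.1 (hperm.mem_iff.2 (List.getElem_mem _))
    have hinj : Function.Injective fun i : Fin m => (⟨l[i], hlt i⟩ : Fin m) := by
      intro i j hij
      have := (hnodup.getElem_inj_iff).1 (Fin.mk.inj hij)
      exact Fin.ext this
    refine ⟨(Equiv.ofBijective _ (Finite.injective_iff_bijective.1 hinj)).symm, ?_⟩
    rw [Vote.ranking, List.map_ofFn]
    refine List.ext_getElem (by simp [hl]) fun i h1 h2 => ?_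
    simp
  have hvotes : ∃ V : WeightedElection m,
      V.map (fun p => (p.1.ranking.map Fin.val, p.2)) = votes := by
    clear h2
    induction votes with
    | nil => exact ⟨[], rfl⟩
    | cons v votes ih =>
      obtain ⟨u, hu⟩ := hvote v List.mem_cons_self
      obtain ⟨V, hV⟩ := ih fun v hv => hvote v (List.mem_cons_of_mem _ hv)
      exact ⟨(u, v.2) :: V, by rw [List.map_cons, hV, hu]⟩
  obtain ⟨V, rfl⟩ := hvotes
  exact ⟨⟨m, V, weights, ⟨t, List.mem_range.1 h3⟩⟩, rfl⟩

theorem encode_raw (I : ManipulationInstance) : I.raw.encode = I.encode := by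
  simp only [encode, ManipulationInstance.raw, ManipulationInstance.encode, encodeListWith,
    List.flatMap_map, ← List.map_coe_finRange_eq_range]
  rfl

theorem idxOf_ranking {m : ℕ} (v : Vote m) (c : Fin m) :
    (v.ranking.map Fin.val).idxOf (c : ℕ) = v c := by
  have hnodup : (v.ranking.map Fin.val).Nodup :=
    (List.nodup_ofFn.2 v.symm.injective).map Fin.val_injective
  have hlen : (v c : ℕ) < (v.ranking.map Fin.val).length := by simp [Vote.ranking]
  have h := hnodup.idxOf_getElem (v c) hlen
  have hget : (v.ranking.map Fin.val)[(v c : ℕ)] = c := by simp [Vote.ranking]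
  rwa [hget] at h

section

variable (I : ManipulationInstance)

theorem voteScore_raw (k : ℕ) (c : Fin I.numCand) :
    I.raw.voteScore k c = I.votes.score (k + 1) c := by
  simp [voteScore, ManipulationInstance.raw, WeightedElection.score, Function.comp_def,
    idxOf_ranking, Vote.pos]

variable {I} {u : Vote I.numCand}

theorem topScore_raw {d : Fin I.numCand} (hd : u.pos d = 1) (k : ℕ) :
    I.raw.topScore d k =
      (I.votes ++ WeightedElection.bloc u I.manipWeights).score (k + 1) d := by
  rw [topScore, voteScore_raw, WeightedElection.score_append, WeightedElection.score_bloc, hd,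
    if_pos (by omega)]
  rfl

theorem targetScore_raw (hc : u.pos I.target = I.numCand) {k : ℕ} (hk : k < I.numCand) :
    I.raw.targetScore k =
      (I.votes ++ WeightedElection.bloc u I.manipWeights).score (k + 1) I.target := by
  rw [targetScore, WeightedElection.score_append, WeightedElection.score_bloc, hc]
  congr 1
  · exact voteScore_raw I k I.target
  · simp only [ManipulationInstance.raw, List.length_range]
    exact if_congr (by omega) rfl rfl

theorem scoreSum_raw (s : ℕ → ℕ) {k : ℕ} (hk : k < I.numCand) :
    I.raw.scoreSum s k = ∑ j ∈ Finset.range (k + 1), s j := by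
  have h : I.raw.scoreSum s k = ∑ j ∈ Finset.range I.numCand, if j ≤ k then s j else 0 := rfl
  rw [h, ← Finset.sum_filter]
  refine Finset.sum_congr ?_ fun _ _ => rfl
  ext j
  simp only [Finset.mem_filter, Finset.mem_range]
  omega

theorem total_raw : I.raw.total =
    (I.votes ++ WeightedElection.bloc u I.manipWeights).total := by
  rw [WeightedElection.total_append, WeightedElection.total_bloc]
  simp [total, ManipulationInstance.raw, WeightedElection.total, Function.comp_def]

theorem behind_raw {V : WeightedElection I.numCand} {s s' : ℕ → ℕ} {x y : Fin I.numCand}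
    (hs : ∀ k < I.numCand, s k = V.score (k + 1) x)
    (hs' : ∀ k < I.numCand, s' k = V.score (k + 1) y) {k : ℕ} (hk : k < I.numCand) :
    I.raw.Behind s s' k ↔ V.key (k + 1) x < V.key (k + 1) y := by
  rw [Behind, WeightedElection.key_lt_key_iff_sum_score, scoreSum_raw s hk, scoreSum_raw s' hk,
    hs k hk, hs' k hk]
  have h : ∀ (s : ℕ → ℕ) (x : Fin I.numCand), (∀ k < I.numCand, s k = V.score (k + 1) x) →
      ∑ j ∈ Finset.range (k + 1), s j = ∑ j ∈ Finset.range (k + 1), V.score (j + 1) x :=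
    fun s x hs => Finset.sum_congr rfl fun j hj => hs j (by
      have := Finset.mem_range.1 hj
      omega)
  rw [h s x hs, h s' y hs']

theorem spoils_raw_iff {d : Fin I.numCand} (hd : u.pos d = 1) (hc : u.pos I.target = I.numCand) :
    I.raw.Spoils d ↔
      (I.votes ++ WeightedElection.bloc u I.manipWeights).Spoils d I.target := by
  set V := I.votes ++ WeightedElection.bloc u I.manipWeights with hV
  have hd' : ∀ k < I.numCand, I.raw.topScore d k = V.score (k + 1) d :=
    fun k _ => topScore_raw hd k
  have hc' : ∀ k < I.numCand, I.raw.targetScore k = V.score (k + 1) I.target :=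
    fun k hk => targetScore_raw hc hk
  have hmaj : V.maj = I.raw.total.div2 + 1 := by
    rw [Nat.div2_val, total_raw (u := u)]
    rfl
  have hmem : ∀ k, k ∈ I.raw.1 ↔ k < I.numCand := fun k => List.mem_range
  rw [Spoils, WeightedElection.Spoils, total_raw (u := u)]
  refine or_congr_right ?_
  rw [← total_raw (u := u)]
  simp only [hmem, WeightedElection.Withstands, hmaj]
  constructor
  · rintro ⟨k, hk, h1, h2, h3⟩
    refine ⟨k + 1, by omega, hk, hd' k hk ▸ h1, fun i h4 h5 => ?_, fun j h4 h5 h6 => ?_⟩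
    · obtain ⟨i, rfl⟩ := Nat.exists_eq_add_of_le' h4
      have := h2 i (by omega) (by omega)
      rw [hc' i (by omega)] at this
      omega
    · obtain ⟨j, rfl⟩ := Nat.exists_eq_add_of_le' (show 1 ≤ j by omega)
      obtain ⟨i, h7, h8, h9, h10⟩ := h3 j h5 (by omega) ((behind_raw hd' hc' h5).2 h6)
      exact ⟨i + 1, by omega, by omega, (behind_raw hc' hd' h7).1 h10⟩
  · rintro ⟨i, h0, hk, h1, h2, h3⟩
    obtain ⟨k, rfl⟩ := Nat.exists_eq_add_of_le' h0
    refine ⟨k, hk, (hd' k hk).symm ▸ h1, fun i h4 h5 => ?_, fun j h4 h5 h6 => ?_⟩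
    · have := h2 (i + 1) (by omega) (by omega)
      rw [hc' i h4]
      omega
    · obtain ⟨i, h7, h8, h9⟩ := h3 (j + 1) (by omega) h4 ((behind_raw hd' hc' h4).1 h6)
      obtain ⟨i, rfl⟩ := Nat.exists_eq_add_of_le' (show 1 ≤ i by omega)
      exact ⟨i, by omega, by omega, by omega, (behind_raw hc' hd' (by omega)).2 h9⟩

variable (I) in
theorem success_raw_iff : I.raw.Success ↔ DestructiveSuccess SkS I := by
  rw [destructiveSuccess_sks_iff]
  constructor
  · rintro ⟨d, hd, hdc, h⟩
    have hd : d < I.numCand := List.mem_range.1 hd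
    have hdc : (⟨d, hd⟩ : Fin I.numCand) ≠ I.target := fun h => hdc (congrArg Fin.val h)
    obtain ⟨u, hu, huc⟩ := WeightedElection.exists_vote hdc
    exact ⟨_, u, hdc, hu, huc, (spoils_raw_iff hu huc).1 h⟩
  · rintro ⟨d, u, hdc, hu, huc, h⟩
    exact ⟨d, List.mem_range.2 d.2, fun h => hdc (Fin.ext h), (spoils_raw_iff hu huc).2 h⟩

end

end RawInstance

/-! ### Plain instances are decided in polynomial time -/

namespace RawInstance

variable {α : Type} [Code α]

theorem polyTime_voteScore {r : α → RawInstance} {k x : α → ℕ} (hr : PolyTime r) (hk : PolyTime k)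
    (hx : PolyTime x) : PolyTime (fun a => (r a).voteScore (k a) (x a)) :=
  .sum (.map (f := fun a v => if v.1.idxOf (x a) ≤ k a then v.2 else 0) (.comp .fst (.comp .snd hr))
    (.if_prop (.decide_le (.idxOf (hx.comp .fst) (.comp .fst .snd)) (hk.comp .fst))
      (.comp .snd .snd) (.const 0)))

theorem polyTime_weightSum {r : α → RawInstance} (hr : PolyTime r) :
    PolyTime (fun a => (r a).2.2.1.sum) :=
  .sum (.comp .fst (.comp .snd (.comp .snd hr)))

theorem polyTime_topScore {r : α → RawInstance} {d k : α → ℕ} (hr : PolyTime r) (hd : PolyTime d)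
    (hk : PolyTime k) : PolyTime (fun a => (r a).topScore (d a) (k a)) :=
  .add (polyTime_voteScore hr hk hd) (polyTime_weightSum hr)

theorem polyTime_target {r : α → RawInstance} (hr : PolyTime r) :
    PolyTime (fun a => (r a).2.2.2) :=
  .comp .snd (.comp .snd (.comp .snd hr))

theorem polyTime_targetScore {r : α → RawInstance} {k : α → ℕ} (hr : PolyTime r)
    (hk : PolyTime k) : PolyTime (fun a => (r a).targetScore (k a)) :=
  .add (polyTime_voteScore hr hk (polyTime_target hr))
    (.if_prop (.decide_eq (.add hk (.const 1)) (.length (.comp .fst hr))) (polyTime_weightSum hr)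
      (.const 0))

theorem polyTime_scoreSum {r : α → RawInstance} {s : α → ℕ → ℕ} {k : α → ℕ} (hr : PolyTime r)
    (hs : PolyTime (fun p : α × ℕ => s p.1 p.2)) (hk : PolyTime k) :
    PolyTime (fun a => (r a).scoreSum (s a) (k a)) :=
  .sum (.map (f := fun a j => if j ≤ k a then s a j else 0) (.comp .fst hr)
    (.if_prop (.decide_le .snd (hk.comp .fst)) hs (.const 0)))

theorem polyTime_total {r : α → RawInstance} (hr : PolyTime r) :
    PolyTime (fun a => (r a).total) :=
  .add (.sum (.map (f := fun _ v => v.2) (.comp .fst (.comp .snd hr)) (.comp .snd .snd)))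
    (polyTime_weightSum hr)

open Classical in
theorem polyTime_behind {r : α → RawInstance} {s s' : α → ℕ → ℕ} {k : α → ℕ} (hr : PolyTime r)
    (hs : PolyTime (fun p : α × ℕ => s p.1 p.2)) (hs' : PolyTime (fun p : α × ℕ => s' p.1 p.2))
    (hk : PolyTime k) : PolyTime (fun a => decide ((r a).Behind (s a) (s' a) (k a))) := by
  have h1 : PolyTime (fun a => s a (k a)) := hs.comp (.pair .id hk)
  have h2 : PolyTime (fun a => s' a (k a)) := hs'.comp (.pair .id hk)
  have h := (h1.decide_lt h2).decide_or ((h1.decide_eq h2).decide_and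
    ((polyTime_scoreSum hr hs hk).decide_lt (polyTime_scoreSum hr hs' hk)))
  convert h
  exact Iff.rfl

open Classical in
theorem polyTime_spoils {r : α → RawInstance} {d : α → ℕ} (hr : PolyTime r) (hd : PolyTime d) :
    PolyTime (fun a => decide ((r a).Spoils (d a))) := by
  have hhalf : PolyTime (fun a => (r a).total.div2) := .div2 (polyTime_total hr)
  have hafter : PolyTime (fun p : α × ℕ => decide (∀ j ∈ (r p.1).1, p.2 ≤ j →
      (r p.1).Behind ((r p.1).topScore (d p.1)) (r p.1).targetScore j →
        ∃ i ∈ (r p.1).1, p.2 ≤ i ∧ i < j ∧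
          (r p.1).Behind (r p.1).targetScore ((r p.1).topScore (d p.1)) i)) := by
    refine .all (p := fun (p : α × ℕ) j => p.2 ≤ j →
      (r p.1).Behind ((r p.1).topScore (d p.1)) (r p.1).targetScore j →
        ∃ i ∈ (r p.1).1, p.2 ≤ i ∧ i < j ∧
          (r p.1).Behind (r p.1).targetScore ((r p.1).topScore (d p.1)) i)
      (.comp .fst (hr.comp .fst)) ?_
    have h1 : PolyTime (fun q : (α × ℕ) × ℕ => r q.1.1) := hr.comp (.comp .fst .fst)
    have h2 : PolyTime (fun q : (α × ℕ) × ℕ => d q.1.1) := hd.comp (.comp .fst .fst)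
    refine .decide_imp (.decide_le (.comp .snd .fst) .snd) (.decide_imp
      (polyTime_behind h1 (polyTime_topScore (h1.comp .fst) (h2.comp .fst) .snd)
        (polyTime_targetScore (h1.comp .fst) .snd) .snd) ?_)
    refine .any (p := fun (q : (α × ℕ) × ℕ) i => q.1.2 ≤ i ∧ i < q.2 ∧
      (r q.1.1).Behind (r q.1.1).targetScore ((r q.1.1).topScore (d q.1.1)) i) (.comp .fst h1) ?_
    have h1 := h1.comp (.fst (β := ℕ))
    have h2 := h2.comp (.fst (β := ℕ))
    exact .decide_and (.decide_le (.comp .snd (.comp .fst .fst)) .snd) (.decide_and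
      (.decide_lt .snd (.comp .snd .fst)) (polyTime_behind h1
        (polyTime_targetScore (h1.comp .fst) .snd)
        (polyTime_topScore (h1.comp .fst) (h2.comp .fst) .snd) .snd))
  have hbefore : PolyTime (fun p : α × ℕ => decide (∀ j ∈ (r p.1).1, j < p.2 →
      (r p.1).targetScore j ≤ (r p.1).total.div2)) :=
    .all (p := fun (p : α × ℕ) j => j < p.2 → (r p.1).targetScore j ≤ (r p.1).total.div2)
      (.comp .fst (hr.comp .fst)) (.decide_imp (.decide_lt .snd (.comp .snd .fst)) (.decide_le
        (polyTime_targetScore (hr.comp (.comp .fst .fst)) .snd) (hhalf.comp (.comp .fst .fst))))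
  have hstage := PolyTime.any (p := fun a k => (r a).total.div2 < (r a).topScore (d a) k ∧
    (∀ j ∈ (r a).1, j < k → (r a).targetScore j ≤ (r a).total.div2) ∧
      ∀ j ∈ (r a).1, k ≤ j → (r a).Behind ((r a).topScore (d a)) (r a).targetScore j →
        ∃ i ∈ (r a).1, k ≤ i ∧ i < j ∧ (r a).Behind (r a).targetScore ((r a).topScore (d a)) i)
    (.comp .fst hr) (.decide_and
      (.decide_lt (hhalf.comp .fst) (polyTime_topScore (hr.comp .fst) (hd.comp .fst) .snd))
      (.decide_and hbefore hafter))
  have h := ((polyTime_total hr).decide_eq (.const 0)).decide_or hstage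
  convert h
  exact Iff.rfl

open Classical in
/-- There are only polynomially many candidates, stages and pairs of stages to be tried. -/
theorem polyTime_success : PolyTime (fun r : RawInstance => decide r.Success) := by
  have h := PolyTime.any (p := fun (r : RawInstance) d => d ≠ r.2.2.2 ∧ r.Spoils d) .fst
    (.decide_and (.decide_not (.decide_eq .snd (polyTime_target .fst)))
      (polyTime_spoils .fst .snd))
  convert h
  exact Iff.rfl

open Classical in
theorem polyTime_valid : PolyTime (fun r : RawInstance => decide r.Valid) := by
  have hvotes := PolyTime.all
    (p := fun (r : RawInstance) v => v.1.length = r.1.length ∧ ∀ x ∈ r.1, x ∈ v.1)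
    (.comp .fst .snd) (.decide_and
      (.decide_eq (.length (.comp .fst .snd)) (.length (.comp .fst .fst)))
      (.all (.comp .fst .fst) (.mem .snd (.comp .fst (.comp .snd .fst)))))
  have h := PolyTime.decide_and (.decide_eq_range .fst)
    (.decide_and hvotes (.mem (polyTime_target .id) .fst))
  convert h
  exact Iff.rfl

end RawInstance

open Classical RawInstance in
/-- A language of encoded instances is in P if membership can be decided in polynomial time from
the plain data. A word that does not encode an instance is rejected because it differs from the
encoding of its decoding or because its decoding is not valid. -/
theorem inP_of_raw {P : ManipulationInstance → Prop} {Q : RawInstance → Prop} [DecidablePred Q]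
    (hQ : PolyTime (fun r => decide (Q r))) (hPQ : ∀ I : ManipulationInstance, Q I.raw ↔ P I) :
    InP {w | ∃ I, P I ∧ I.encode = w} := by
  have h := ((polyTime_encode.comp polyTime_decode).decide_eq_list .id).decide_and
    ((polyTime_valid.comp polyTime_decode).decide_and (hQ.comp polyTime_decode))
  refine h.inP fun w => ?_
  rw [decide_eq_true_eq]
  constructor
  · rintro ⟨h1, h2, h3⟩
    obtain ⟨I, hI⟩ := h2.exists_raw_eq
    rw [← hI] at h1 h3
    exact ⟨I, (hPQ I).1 h3, (encode_raw I).symm.trans h1⟩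
  · rintro ⟨I, h1, rfl⟩
    rw [← encode_raw, decode_encode]
    exact ⟨rfl, valid_raw I, (hPQ I).2 h1⟩

end Voting

theorem theorem4 :
    Voting.InP (Voting.DCWM Voting.SkS) ∧
      Voting.InP (Voting.DCM Voting.SkS) ∧
      Voting.InP (Voting.DM Voting.SkS) := by
  classical
  have hunit : StackProg.PolyTime (fun r : Voting.RawInstance => decide
      ((∀ v ∈ r.2.1, v.2 = 1) ∧ ∀ w ∈ r.2.2.1, w = 1)) :=
    .decide_and (.all (.comp .fst .snd) (.decide_eq (.comp .snd .snd) (.const 1)))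
      (.all (.comp .fst (.comp .snd .snd)) (.decide_eq .snd (.const 1)))
  have hraw : ∀ I : Voting.ManipulationInstance,
      ((∀ v ∈ I.raw.2.1, v.2 = 1) ∧ ∀ w ∈ I.raw.2.2.1, w = 1) ↔ I.Unweighted := fun I => by
    simp only [Voting.ManipulationInstance.raw, Voting.ManipulationInstance.Unweighted,
      List.forall_mem_map]
  have hsingle : StackProg.PolyTime (fun r : Voting.RawInstance => decide (r.2.2.1.length = 1)) :=
    .decide_eq (.length (.comp .fst (.comp .snd .snd))) (.const 1)
  have hsuccess := Voting.RawInstance.polyTime_success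
  have hiff := Voting.RawInstance.success_raw_iff
  refine ⟨Voting.inP_of_raw hsuccess hiff, ?_, ?_⟩
  · have h := Voting.inP_of_raw
      (P := fun I => I.Unweighted ∧ Voting.DestructiveSuccess Voting.SkS I)
      (Q := fun r => ((∀ v ∈ r.2.1, v.2 = 1) ∧ ∀ w ∈ r.2.2.1, w = 1) ∧ r.Success)
      (hunit.decide_and hsuccess) fun I => and_congr (hraw I) (hiff I)
    simp only [and_assoc] at h
    exact h
  · have h := Voting.inP_of_raw (P := fun I => I.Unweighted ∧ I.manipWeights.length = 1 ∧
        Voting.DestructiveSuccess Voting.SkS I)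
      (Q := fun r => ((∀ v ∈ r.2.1, v.2 = 1) ∧ ∀ w ∈ r.2.2.1, w = 1) ∧
        r.2.2.1.length = 1 ∧ r.Success)
      (hunit.decide_and (hsingle.decide_and hsuccess))
      fun I => and_congr (hraw I) (and_congr Iff.rfl (hiff I))
    simp only [and_assoc] at h
    exact h
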